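/- Let $\Omega\subset\mathbb R^N$ be a bounded domain (nonempty, connected, open) with $C^2$ boundary, $\delta(x)=\operatorname{dist}(x,\partial\Omega)$, and let $s,\gamma\in(0,1]$ with $N>2s$ and $\gamma\ge s-\frac12$. Let $\mathcal L:C_c^\infty(\Omega)\subset L^2(\Omega)\to L^2(\Omega)$ be a linear, positive, symmetric operator, i.e. $\mathcal B(\varphi,\psi):=\int_\Omega\varphi\,\mathcal L\psi\,dx$ is symmetric and $\mathcal B(\varphi,\varphi)\ge0$ on $C_c^\infty(\Omega)$. Let $\mathbb H(\Omega)\subset L^2(\Omega)$ be the completion of $C_c^\infty(\Omega)$ in the norm $\|u\|_{L^2(\Omega)}+\sqrt{\mathcal B(u,u)}$, extend $\mathcal B$ to $\mathbb H(\Omega)$ by continuity, write $\|\xi\|_{\mathbb H(\Omega)}^2:=\mathcal B(\xi,\xi)$, and denote again by $\mathcal L$ the self-adjoint operator in $L^2(\Omega)$ associated with this form: $\mathcal Lu=f$ means that $u\in\mathbb H(\Omega)$ and $\mathcal B(u,v)=\int_\Omega fv\,dx$ for all $v\in\mathbb H(\Omega)$. Assume: (a) There is a measurable symmetric kernel $G:\{(x,y)\in\Omega\times\Omega:x\ne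 y\}\to(0,\infty)$ such that for every $f\in C_c^\infty(\Omega)$ the unique solution of $\mathcal Lu=f$ is $u=\mathbb G[f]:=\int_\Omega G(\cdot,y)f(y)\,dy$ (a.e. in $\Omega$), and, for some constants $c,C>0$ and all $x\neq y$ in $\Omega$, $$c\,k(x,y)\le G(x,y)\le C\,k(x,y),\qquad k(x,y)=\frac1{|x-y|^{N-2s}}\Big(\frac{\delta(x)}{|x-y|}\wedge1\Big)^{\gamma}\Big(\frac{\delta(y)}{|x-y|}\wedge1\Big)^{\gamma}.$$ (b) $\mathbb H(\Omega)=H^s_{00}(\Omega):=\{u\in H^s(\Omega):u/\delta^s\in L^2(\Omega)\}$. (c) $N\ge 4s$ if $\gamma<2s$, and $N\ge4s(1+\gamma)-\gamma$ if $\gamma\ge2s$. Let $1<p<p^*:=\frac{N+\gamma}{N+\gamma-2s}$ and let $\mu$ be a positive Radon measure on $\Omega$ with $\int_\Omega\delta^\gamma\,d\mu=1$. For $\lambda>0$, a nonnegative weak-dual solution of $\mathcal Lu=u^p+\lambda\mu$ in $\Omega$ (with homogeneous boundary or exterior condition) is a measurable function $u\ge0$ a.e. on $\Omega$ with $\int_\Omega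 u^p\delta^\gamma\,dx<\infty$ and $$\int_\Omega u\,\xi\,dx=\int_\Omega u^p\,\mathbb G[\xi]\,dx+\lambda\int_\Omega\mathbb G[\xi]\,d\mu\qquad\text{for all }\xi\in\delta^\gamma L^\infty(\Omega).$$ Let $\lambda^*$ be the supremum of all $\lambda>0$ for which there is such a solution that is positive a.e. in $\Omega$. Then for every $\lambda\in(0,\lambda^*)$ there is a minimal nonnegative weak-dual solution $\underline u_\lambda$ (one that is a.e. less than or equal to every nonnegative weak-dual solution with the same $\lambda$), and it is stable: for every $\xi\in\mathbb H(\Omega)\setminus\{0\}$ the integral below is finite and $$\|\xi\|^2_{\mathbb H(\Omega)}>p\int_\Omega\underline u_\lambda^{\,p-1}\xi^2\,dx .$$ -/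

import Mathlib

open MeasureTheory Filter Topology Set TopologicalSpace
open scoped Distributions

noncomputable section

namespace SemilinearGreen

/-! ### The domain, the distance to the boundary, weighted spaces -/

/-- `ℝ^N` with its Euclidean structure. -/
abbrev Space (N : ℕ) : Type := EuclideanSpace ℝ (Fin N)

variable {N : ℕ}

/-- Lebesgue measure on `Ω`. -/
abbrev vol (Ω : Opens (Space N)) : Measure (Space N) := volume.restrict (Ω : Set (Space N))

/-- The real Hilbert space `L²(Ω)`. -/
abbrev L2 (Ω : Opens (Space N)) : Type := Lp ℝ 2 (vol Ω)

/-- Bounded domain (nonempty connected open set) with `C²` boundary: near every boundary point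
the set is a sublevel set `{ρ < 0}` of a `C²` function with nonvanishing differential. -/
structure IsBoundedC2Domain (Ω : Opens (Space N)) : Prop where
  connected : IsConnected (Ω : Set (Space N))
  bounded : Bornology.IsBounded (Ω : Set (Space N))
  boundary : ∀ z ∈ frontier (Ω : Set (Space N)), ∃ U : Set (Space N), IsOpen U ∧ z ∈ U ∧
    ∃ ρ : Space N → ℝ, ContDiffOn ℝ 2 ρ U ∧ fderiv ℝ ρ z ≠ 0 ∧
      ∀ x ∈ U, x ∈ Ω ↔ ρ x < 0

/-- `δ(x) = dist(x, ∂Ω)`. -/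
def bdist (Ω : Opens (Space N)) (x : Space N) : ℝ :=
  Metric.infDist x (frontier (Ω : Set (Space N)))

/-- `u ∈ L^q(Ω, δ^γ)`. Since `δ^γ` is continuous and positive in `Ω`, local `q`-integrability
is automatic. -/
def MemWeightedLp (Ω : Opens (Space N)) (γ q : ℝ) (u : Space N → ℝ) : Prop :=
  AEStronglyMeasurable u (vol Ω) ∧
    Integrable (fun x => |u x| ^ q * bdist Ω x ^ γ) (vol Ω)

/-- `ξ ∈ δ^γ L^∞(Ω)`. -/
def MemWeightedLinfty (Ω : Opens (Space N)) (γ : ℝ) (ξ : Space N → ℝ) : Prop :=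
  ∃ v : Space N → ℝ, MemLp v ⊤ (vol Ω) ∧ ξ =ᵐ[vol Ω] fun x => bdist Ω x ^ γ * v x

/-- `μ ∈ 𝓜⁺(Ω, δ^γ)` with `‖μ‖ = ∫_Ω δ^γ dμ = 1`. A Borel measure carried by `Ω` with finite
weighted mass is finite on compact subsets of `Ω`, hence a Radon measure on `Ω`. -/
def IsNormalizedDatum (Ω : Opens (Space N)) (γ : ℝ) (μ : Measure (Space N)) : Prop :=
  μ (Ω : Set (Space N))ᶜ = 0 ∧
    ∫⁻ x in (Ω : Set (Space N)), ENNReal.ofReal (bdist Ω x ^ γ) ∂μ = 1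

/-! ### The space `H^s_00(Ω)` -/

/-- `u ∈ L²(Ω)` has weak partial derivatives in `L²(Ω)`, i.e. `u ∈ H¹(Ω)`. -/
def MemH1 (Ω : Opens (Space N)) (u : L2 Ω) : Prop :=
  ∀ i : Fin N, ∃ g : L2 Ω, ∀ φ : 𝓓(Ω, ℝ),
    ∫ x in (Ω : Set (Space N)), u x * fderiv ℝ φ x (EuclideanSpace.single i 1) =
      - ∫ x in (Ω : Set (Space N)), g x * φ x

/-- `u ∈ L²(Ω)` has finite Gagliardo seminorm of order `s`. -/
def FiniteGagliardo (Ω : Opens (Space N)) (s : ℝ) (u : L2 Ω) : Prop :=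
  ∫⁻ x in (Ω : Set (Space N)), ∫⁻ y in (Ω : Set (Space N)),
    ENNReal.ofReal (|u x - u y| ^ 2 / ‖x - y‖ ^ ((N : ℝ) + 2 * s)) < ⊤

/-- `u ∈ H^s(Ω)`, for `0 < s ≤ 1`. -/
def MemHs (Ω : Opens (Space N)) (s : ℝ) (u : L2 Ω) : Prop :=
  (s < 1 ∧ FiniteGagliardo Ω s u) ∨ (s = 1 ∧ MemH1 Ω u)

/-- `u ∈ H^s_00(Ω)`, i.e. `u ∈ H^s(Ω)` and `u / δ^s ∈ L²(Ω)`. -/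
def MemHs00 (Ω : Opens (Space N)) (s : ℝ) (u : L2 Ω) : Prop :=
  MemHs Ω s u ∧ MemLp (fun x => u x / bdist Ω x ^ s) 2 (vol Ω)

/-! ### The operator on test functions and the closure of its quadratic form -/

theorem memLp_testFunction (Ω : Opens (Space N)) (φ : 𝓓(Ω, ℝ)) : MemLp φ 2 (vol Ω) :=
  φ.continuous.memLp_of_hasCompactSupport φ.hasCompactSupport

/-- The inclusion `C_c^∞(Ω) ⊂ L²(Ω)`. -/
def testToL2 (Ω : Opens (Space N)) : 𝓓(Ω, ℝ) →ₗ[ℝ] L2 Ω where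
  toFun φ := (memLp_testFunction Ω φ).toLp φ
  map_add' _ _ := rfl
  map_smul' _ _ := rfl

variable {Ω : Opens (Space N)}

/-- The bilinear form `𝓑(φ, ψ) = ∫_Ω φ 𝓛ψ dx` on `C_c^∞(Ω)`. -/
def testForm (L : 𝓓(Ω, ℝ) →ₗ[ℝ] L2 Ω) (φ ψ : 𝓓(Ω, ℝ)) : ℝ :=
  inner ℝ (testToL2 Ω φ) (L ψ)

/-- `𝓛 : C_c^∞(Ω) ⊂ L²(Ω) → L²(Ω)` is positive and symmetric. -/
structure IsPositiveSymmetric (L : 𝓓(Ω, ℝ) →ₗ[ℝ] L2 Ω) : Prop where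
  nonneg : ∀ φ, 0 ≤ testForm L φ φ
  symm : ∀ φ ψ, testForm L φ ψ = testForm L ψ φ

/-- The sequence of test functions `φ n` converges to `u` in `L²(Ω)` and is Cauchy with respect
to the form `𝓑`. -/
def IsApprox (L : 𝓓(Ω, ℝ) →ₗ[ℝ] L2 Ω) (φ : ℕ → 𝓓(Ω, ℝ)) (u : L2 Ω) : Prop :=
  Tendsto (fun n => testToL2 Ω (φ n)) atTop (𝓝 u) ∧
    ∀ ε > 0, ∃ n₀, ∀ m ≥ n₀, ∀ n ≥ n₀, testForm L (φ m - φ n) (φ m - φ n) < ε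

/-- `ℍ(Ω)`, the form domain of the extended operator: the completion of `C_c^∞(Ω)` in the norm
`‖u‖_{L²} + 𝓑(u,u)^{1/2}`, realized inside `L²(Ω)`. -/
def formDomain (L : 𝓓(Ω, ℝ) →ₗ[ℝ] L2 Ω) : Set (L2 Ω) :=
  {u | ∃ φ, IsApprox L φ u}

open Classical in
/-- Some sequence of test functions approximating an element of the form domain. -/
def approxSeq (L : 𝓓(Ω, ℝ) →ₗ[ℝ] L2 Ω) (u : L2 Ω) : ℕ → 𝓓(Ω, ℝ) :=
  if h : ∃ φ, IsApprox L φ u then h.choose else 0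

/-- The extension of `𝓑` to `ℍ(Ω)` by continuity; it is the inner product of `ℍ(Ω)`.
It does not depend on the approximating sequences, see `tendsto_testForm`. -/
def closedForm (L : 𝓓(Ω, ℝ) →ₗ[ℝ] L2 Ω) (u v : L2 Ω) : ℝ :=
  limUnder atTop fun n => testForm L (approxSeq L u n) (approxSeq L v n)

theorem testForm_cauchySchwarz {L : 𝓓(Ω, ℝ) →ₗ[ℝ] L2 Ω} (hL : IsPositiveSymmetric L)
    (φ ψ : 𝓓(Ω, ℝ)) : testForm L φ ψ ^ 2 ≤ testForm L φ φ * testForm L ψ ψ := by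
  have key : ∀ t : ℝ, 0 ≤ testForm L ψ ψ * (t * t) + 2 * testForm L φ ψ * t + testForm L φ φ := by
    intro t
    have h := hL.nonneg (φ + t • ψ)
    have hs := hL.symm ψ φ
    have e : testForm L (φ + t • ψ) (φ + t • ψ) =
        testForm L φ φ + t * testForm L φ ψ + (t * testForm L ψ φ + t * (t * testForm L ψ ψ)) := by
      simp only [testForm, map_add, map_smul, inner_add_left, inner_add_right,
        real_inner_smul_left, real_inner_smul_right]
      ring
    rw [e, hs] at h
    linarith
  have := discrim_le_zero key
  rw [discrim] at this
  nlinarith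

/-- A `𝓑`-Cauchy sequence of test functions that tends to `0` in `L²(Ω)` has energy tending
to `0`: the form is closable. -/
theorem tendsto_testForm_zero {L : 𝓓(Ω, ℝ) →ₗ[ℝ] L2 Ω} (hL : IsPositiveSymmetric L)
    {φ : ℕ → 𝓓(Ω, ℝ)} (h : IsApprox L φ 0) :
    Tendsto (fun n => testForm L (φ n) (φ n)) atTop (𝓝 0) := by
  rw [Metric.tendsto_atTop]
  intro ε hε
  obtain ⟨n₀, hn₀⟩ := h.2 (ε / 4) (by positivity)
  refine ⟨n₀, fun n hn => ?_⟩
  rw [Real.dist_eq, sub_zero, abs_of_nonneg (hL.nonneg _)]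
  -- the energy of `φ n` is at most twice that of `φ n - φ m` plus a term tending to zero
  have hlim : Tendsto (fun m => testForm L (φ m) (φ n)) atTop (𝓝 0) := by
    have := h.1.inner (𝕜 := ℝ) (tendsto_const_nhds (x := L (φ n)))
    simpa [testForm] using this
  have hev : ∀ᶠ m in atTop, testForm L (φ n) (φ n) ≤ ε / 4 + 2 * testForm L (φ m) (φ n) := by
    filter_upwards [eventually_ge_atTop n₀] with m hm
    have h1 := hn₀ n hn m hm
    have h2 := hL.nonneg (φ m)
    have h3 := hL.symm (φ n) (φ m)
    have e : testForm L (φ n - φ m) (φ n - φ m) =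
        testForm L (φ n) (φ n) - testForm L (φ n) (φ m) -
          (testForm L (φ m) (φ n) - testForm L (φ m) (φ m)) := by
      simp only [testForm, map_sub, inner_sub_left, inner_sub_right]
      ring
    rw [e, h3] at h1
    linarith
  have := ge_of_tendsto (tendsto_const_nhds.add (hlim.const_mul 2)) hev
  linarith

theorem IsApprox.sub {L : 𝓓(Ω, ℝ) →ₗ[ℝ] L2 Ω} (hL : IsPositiveSymmetric L)
    {φ ψ : ℕ → 𝓓(Ω, ℝ)} {u v : L2 Ω} (hφ : IsApprox L φ u) (hψ : IsApprox L ψ v) :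
    IsApprox L (fun n => φ n - ψ n) (u - v) := by
  refine ⟨by simpa using hφ.1.sub hψ.1, fun ε hε => ?_⟩
  obtain ⟨n₁, h₁⟩ := hφ.2 (ε / 4) (by positivity)
  obtain ⟨n₂, h₂⟩ := hψ.2 (ε / 4) (by positivity)
  refine ⟨max n₁ n₂, fun m hm n hn => ?_⟩
  have a := h₁ m (le_trans (le_max_left _ _) hm) n (le_trans (le_max_left _ _) hn)
  have b := h₂ m (le_trans (le_max_right _ _) hm) n (le_trans (le_max_right _ _) hn)
  set α := φ m - φ n
  set β := ψ m - ψ n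
  have c : φ m - ψ m - (φ n - ψ n) = α - β := by simp only [α, β]; abel
  have d := hL.nonneg (α + β)
  have e1 : testForm L (α + β) (α + β) + testForm L (α - β) (α - β) =
      2 * testForm L α α + 2 * testForm L β β := by
    simp only [testForm, map_sub, map_add, inner_sub_left, inner_sub_right, inner_add_left,
      inner_add_right]
    ring
  show testForm L (φ m - ψ m - (φ n - ψ n)) (φ m - ψ m - (φ n - ψ n)) < ε
  rw [c]
  linarith

theorem isApprox_approxSeq {L : 𝓓(Ω, ℝ) →ₗ[ℝ] L2 Ω} {u : L2 Ω} (hu : u ∈ formDomain L) :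
    IsApprox L (approxSeq L u) u := by
  have h : ∃ φ, IsApprox L φ u := hu
  rw [approxSeq, dif_pos h]
  exact h.choose_spec

theorem IsApprox.bounded {L : 𝓓(Ω, ℝ) →ₗ[ℝ] L2 Ω} (hL : IsPositiveSymmetric L)
    {φ : ℕ → 𝓓(Ω, ℝ)} {u : L2 Ω} (hφ : IsApprox L φ u) :
    ∃ C n₀, ∀ n ≥ n₀, testForm L (φ n) (φ n) ≤ C := by
  obtain ⟨n₀, h₀⟩ := hφ.2 1 one_pos
  refine ⟨2 + 2 * testForm L (φ n₀) (φ n₀), n₀, fun n hn => ?_⟩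
  have a := h₀ n hn n₀ le_rfl
  have d := hL.nonneg ((φ n - φ n₀) - φ n₀)
  have e : testForm L ((φ n - φ n₀) - φ n₀) ((φ n - φ n₀) - φ n₀) + testForm L (φ n) (φ n) =
      2 * testForm L (φ n - φ n₀) (φ n - φ n₀) + 2 * testForm L (φ n₀) (φ n₀) := by
    simp only [testForm, map_sub, inner_sub_left, inner_sub_right]
    ring
  linarith

theorem tendsto_testForm_left {L : 𝓓(Ω, ℝ) →ₗ[ℝ] L2 Ω} (hL : IsPositiveSymmetric L)
    {d ψ : ℕ → 𝓓(Ω, ℝ)} {v : L2 Ω} (hd : Tendsto (fun n => testForm L (d n) (d n)) atTop (𝓝 0))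
    (hψ : IsApprox L ψ v) : Tendsto (fun n => testForm L (d n) (ψ n)) atTop (𝓝 0) := by
  obtain ⟨C, n₀, hC⟩ := hψ.bounded hL
  have hsq : Tendsto (fun n => testForm L (d n) (ψ n) ^ 2) atTop (𝓝 0) := by
    have hb : Tendsto (fun n => testForm L (d n) (d n) * C) atTop (𝓝 0) := by
      simpa using hd.mul_const C
    refine tendsto_of_tendsto_of_tendsto_of_le_of_le' tendsto_const_nhds hb
      (Eventually.of_forall fun n => sq_nonneg _) ?_
    filter_upwards [eventually_ge_atTop n₀] with n hn
    exact (testForm_cauchySchwarz hL _ _).trans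
      (mul_le_mul_of_nonneg_left (hC n hn) (hL.nonneg _))
  have := hsq.sqrt
  simp only [Real.sqrt_sq_eq_abs, Real.sqrt_zero] at this
  exact (tendsto_zero_iff_abs_tendsto_zero _).2 this

/-- Along approximating sequences the form converges. -/
theorem exists_tendsto_testForm {L : 𝓓(Ω, ℝ) →ₗ[ℝ] L2 Ω} (hL : IsPositiveSymmetric L)
    {φ ψ : ℕ → 𝓓(Ω, ℝ)} {u v : L2 Ω} (hφ : IsApprox L φ u) (hψ : IsApprox L ψ v) :
    ∃ b, Tendsto (fun n => testForm L (φ n) (ψ n)) atTop (𝓝 b) := by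
  -- polarization reduces this to one sequence, whose energies form a Cauchy sequence
  have cau : ∀ (χ : ℕ → 𝓓(Ω, ℝ)) (w : L2 Ω), IsApprox L χ w →
      ∃ b, Tendsto (fun n => testForm L (χ n) (χ n)) atTop (𝓝 b) := by
    intro χ w hχ
    have hsqrt : CauchySeq fun n => Real.sqrt (testForm L (χ n) (χ n)) := by
      have tri : ∀ α β : 𝓓(Ω, ℝ), Real.sqrt (testForm L α α) ≤
          Real.sqrt (testForm L (α - β) (α - β)) + Real.sqrt (testForm L β β) := by
        intro α β
        have p1 := hL.nonneg (α - β)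
        have p2 := hL.nonneg β
        have cs := testForm_cauchySchwarz hL (α - β) β
        refine Real.sqrt_le_iff.2 ⟨by positivity, ?_⟩
        have e : testForm L α α = testForm L (α - β) (α - β) + 2 * testForm L (α - β) β +
            testForm L β β := by
          have hs := hL.symm (α - β) β
          have e' : testForm L α α = testForm L (α - β) (α - β) + testForm L (α - β) β +
              testForm L β (α - β) + testForm L β β := by
            simp only [testForm, map_sub, inner_sub_left, inner_sub_right]
            ring
          linarith
        have q1 := Real.sq_sqrt p1
        have q2 := Real.sq_sqrt p2
        have h12 : testForm L (α - β) β ≤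
            Real.sqrt (testForm L (α - β) (α - β)) * Real.sqrt (testForm L β β) := by
          rw [← Real.sqrt_mul p1]
          exact Real.le_sqrt_of_sq_le cs
        rw [e]
        nlinarith
      rw [Metric.cauchySeq_iff]
      intro ε hε
      obtain ⟨n₀, h₀⟩ := hχ.2 (ε ^ 2) (by positivity)
      refine ⟨n₀, fun m hm n hn => ?_⟩
      have small : ∀ i ≥ n₀, ∀ j ≥ n₀,
          Real.sqrt (testForm L (χ i - χ j) (χ i - χ j)) < ε := fun i hi j hj =>
        (Real.sqrt_lt' hε).2 (h₀ i hi j hj)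
      rw [Real.dist_eq, abs_lt]
      constructor
      · linarith [tri (χ n) (χ m), small n hn m hm]
      · linarith [tri (χ m) (χ n), small m hm n hn]
    obtain ⟨b, hb⟩ := cauchySeq_tendsto_of_complete hsqrt
    refine ⟨b ^ 2, (hb.pow 2).congr fun n => ?_⟩
    exact Real.sq_sqrt (hL.nonneg _)
  have hneg : IsApprox L (fun n => -ψ n) (-v) := by
    refine ⟨by simpa using hψ.1.neg, fun ε hε => ?_⟩
    obtain ⟨n₀, h₀⟩ := hψ.2 ε hε
    refine ⟨n₀, fun m hm n hn => ?_⟩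
    have := h₀ m hm n hn
    have e : testForm L (-ψ m - -ψ n) (-ψ m - -ψ n) =
        testForm L (ψ m - ψ n) (ψ m - ψ n) := by
      simp only [testForm, map_sub, map_neg, inner_sub_left, inner_sub_right, inner_neg_left,
        inner_neg_right]
      ring
    show testForm L (-ψ m - -ψ n) (-ψ m - -ψ n) < ε
    rw [e]
    exact this
  obtain ⟨b₁, h₁⟩ := cau _ _ (hφ.sub hL hψ)
  obtain ⟨b₂, h₂⟩ := cau _ _ (hφ.sub hL hneg)
  refine ⟨(b₂ - b₁) / 4, ((h₂.sub h₁).div_const 4).congr fun n => ?_⟩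
  have hs := hL.symm (φ n) (ψ n)
  have e : testForm L (φ n - -ψ n) (φ n - -ψ n) - testForm L (φ n - ψ n) (φ n - ψ n) =
      2 * testForm L (φ n) (ψ n) + 2 * testForm L (ψ n) (φ n) := by
    simp only [testForm, map_sub, map_neg, inner_sub_left, inner_sub_right, inner_neg_left,
      inner_neg_right]
    ring
  rw [e]
  linarith

/-- The extended form is well defined: it is the limit of `𝓑` along any approximating
sequences. -/
theorem tendsto_testForm {L : 𝓓(Ω, ℝ) →ₗ[ℝ] L2 Ω} (hL : IsPositiveSymmetric L)
    {φ ψ : ℕ → 𝓓(Ω, ℝ)} {u v : L2 Ω} (hφ : IsApprox L φ u) (hψ : IsApprox L ψ v) :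
    Tendsto (fun n => testForm L (φ n) (ψ n)) atTop (𝓝 (closedForm L u v)) := by
  have au := isApprox_approxSeq (L := L) (u := u) ⟨φ, hφ⟩
  have av := isApprox_approxSeq (L := L) (u := v) ⟨ψ, hψ⟩
  have hlim : Tendsto (fun n => testForm L (approxSeq L u n) (approxSeq L v n)) atTop
      (𝓝 (closedForm L u v)) := tendsto_nhds_limUnder (exists_tendsto_testForm hL au av)
  have d1 := tendsto_testForm_zero hL (by simpa using hφ.sub hL au)
  have d2 := tendsto_testForm_zero hL (by simpa using hψ.sub hL av)
  have t1 := tendsto_testForm_left hL d1 hψ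
  have t2 := tendsto_testForm_left hL d2 au
  have := (hlim.add t1).add t2
  rw [add_zero, add_zero] at this
  refine this.congr fun n => ?_
  have hs := hL.symm (ψ n - approxSeq L v n) (approxSeq L u n)
  rw [hs]
  simp only [testForm, map_sub, inner_sub_left, inner_sub_right]
  ring

/-- On test functions the extended form is `𝓑`. -/
theorem closedForm_testToL2 {L : 𝓓(Ω, ℝ) →ₗ[ℝ] L2 Ω} (hL : IsPositiveSymmetric L)
    (φ ψ : 𝓓(Ω, ℝ)) : closedForm L (testToL2 Ω φ) (testToL2 Ω ψ) = testForm L φ ψ := by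
  have h : ∀ χ : 𝓓(Ω, ℝ), IsApprox L (fun _ => χ) (testToL2 Ω χ) := fun χ =>
    ⟨tendsto_const_nhds, fun ε hε => ⟨0, fun m _ n _ => by simpa [testForm] using hε⟩⟩
  exact tendsto_nhds_unique (tendsto_testForm hL (h φ) (h ψ)) tendsto_const_nhds

/-- `u` lies in the domain of the self-adjoint operator associated with the closed form (the
extended operator `𝓛`) and `𝓛 u = f`. -/
def ExtendedEq (L : 𝓓(Ω, ℝ) →ₗ[ℝ] L2 Ω) (u f : L2 Ω) : Prop :=
  u ∈ formDomain L ∧ ∀ v ∈ formDomain L, closedForm L u v = inner ℝ f v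

/-! ### The Green kernel and the structural assumptions -/

variable (Ω)

/-- The Green operator `𝔾[f](x) = ∫_Ω G(x,y) f(y) dy`. -/
def greenOp (G : Space N → Space N → ℝ) (f : Space N → ℝ) (x : Space N) : ℝ :=
  ∫ y in (Ω : Set (Space N)), G x y * f y

/-- The comparison kernel
`|x-y|^{2s-N} (δ(x)/|x-y| ∧ 1)^γ (δ(y)/|x-y| ∧ 1)^γ`. -/
def modelKernel (s γ : ℝ) (x y : Space N) : ℝ :=
  1 / ‖x - y‖ ^ ((N : ℝ) - 2 * s) * min (bdist Ω x / ‖x - y‖) 1 ^ γ *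
    min (bdist Ω y / ‖x - y‖) 1 ^ γ

/-- The set of pairs of different points of `Ω`. -/
def offDiag : Set (Space N × Space N) := {z | z.1 ∈ Ω ∧ z.2 ∈ Ω ∧ z.1 ≠ z.2}

/-- `G` is the Green kernel of `𝓛`: for every `f ∈ C_c^∞(Ω)` the unique solution of `𝓛 u = f`
(with zero boundary or exterior values) is `𝔾[f]`; the kernel is measurable, positive and symmetric
off the diagonal of `Ω × Ω` and comparable with the model kernel there. -/
structure IsGreenKernel (s γ : ℝ) (L : 𝓓(Ω, ℝ) →ₗ[ℝ] L2 Ω) (G : Space N → Space N → ℝ) :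
    Prop where
  measurable : Measurable ((offDiag Ω).indicator fun z => G z.1 z.2)
  pos : ∀ x ∈ Ω, ∀ y ∈ Ω, x ≠ y → 0 < G x y
  symm : ∀ x ∈ Ω, ∀ y ∈ Ω, x ≠ y → G x y = G y x
  estimate : ∃ c > 0, ∃ C > 0, ∀ x ∈ Ω, ∀ y ∈ Ω, x ≠ y →
    c * modelKernel Ω s γ x y ≤ G x y ∧ G x y ≤ C * modelKernel Ω s γ x y
  solves : ∀ (f : 𝓓(Ω, ℝ)) (u : L2 Ω),
    ExtendedEq L u (testToL2 Ω f) ↔ u =ᵐ[vol Ω] greenOp Ω G f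

/-- Conditions on the exponents and the dimension. -/
structure AdmissibleExponents (N : ℕ) (s γ : ℝ) : Prop where
  s_pos : 0 < s
  s_le : s ≤ 1
  γ_pos : 0 < γ
  γ_le : γ ≤ 1
  dim : 2 * s < N
  γ_ge : s - 1 / 2 ≤ γ

open Classical in
/-- The dimensional threshold `N_{s,γ}`. -/
def dimThreshold (s γ : ℝ) : ℝ := if γ < 2 * s then 4 * s else 4 * s * (1 + γ) - γ

/-- The critical exponent `p* = (N+γ)/(N+γ-2s)`. -/
def pStar (N : ℕ) (s γ : ℝ) : ℝ := ((N : ℝ) + γ) / ((N : ℝ) + γ - 2 * s)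

/-! ### Weak-dual solutions of `𝓛 u = u^p + λ μ`, minimality, stability -/

/-- `u` is a weak-dual solution of `𝓛 u = u^p + λ μ` with homogeneous boundary condition.
It is used for (a.e.) nonnegative `u` only. -/
def IsWeakDualSolution (γ p : ℝ) (G : Space N → Space N → ℝ) (μ : Measure (Space N)) (lam : ℝ)
    (u : Space N → ℝ) : Prop :=
  MemWeightedLp Ω γ p u ∧ ∀ ξ : Space N → ℝ, MemWeightedLinfty Ω γ ξ →
    ∫ x in (Ω : Set (Space N)), u x * ξ x =
      (∫ x in (Ω : Set (Space N)), u x ^ p * greenOp Ω G ξ x) +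
        lam * ∫ x in (Ω : Set (Space N)), greenOp Ω G ξ x ∂μ

/-- Nonnegative weak-dual solutions. -/
def IsNonnegSolution (γ p : ℝ) (G : Space N → Space N → ℝ) (μ : Measure (Space N)) (lam : ℝ)
    (u : Space N → ℝ) : Prop :=
  (∀ᵐ x ∂vol Ω, 0 ≤ u x) ∧ IsWeakDualSolution Ω γ p G μ lam u

/-- The minimal nonnegative weak-dual solution. -/
def IsMinimalSolution (γ p : ℝ) (G : Space N → Space N → ℝ) (μ : Measure (Space N)) (lam : ℝ)
    (u : Space N → ℝ) : Prop :=
  IsNonnegSolution Ω γ p G μ lam u ∧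
    ∀ v, IsNonnegSolution Ω γ p G μ lam v → ∀ᵐ x ∂vol Ω, u x ≤ v x

/-- `λ* = sup {λ > 0 : there is a positive weak-dual solution}`, as an extended real. -/
def lambdaStar (γ p : ℝ) (G : Space N → Space N → ℝ) (μ : Measure (Space N)) : EReal :=
  sSup {l : EReal | ∃ lam : ℝ, l = (lam : EReal) ∧ 0 < lam ∧
    ∃ u, (∀ᵐ x ∂vol Ω, 0 < u x) ∧ IsWeakDualSolution Ω γ p G μ lam u}

variable {Ω}

/-- Stability: `‖ξ‖²_ℍ > p ∫_Ω u^{p-1} ξ²` for all nonzero `ξ ∈ ℍ(Ω)`, the integral being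
finite. -/
def IsStable (L : 𝓓(Ω, ℝ) →ₗ[ℝ] L2 Ω) (p : ℝ) (u : Space N → ℝ) : Prop :=
  ∀ ξ ∈ formDomain L, ξ ≠ 0 →
    Integrable (fun x => u x ^ (p - 1) * ξ x ^ 2) (vol Ω) ∧
      p * ∫ x in (Ω : Set (Space N)), u x ^ (p - 1) * ξ x ^ 2 < closedForm L ξ ξ

end SemilinearGreen

end

/-!
The proof uses the quadratic form, and the positivity, the symmetry and the upper bound of the
Green kernel.

The Green operator maps `δ^γ L^∞` to itself (`modelKernel_mul_le`, `exists_greenKernel_bound`).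
Hence all integrals in the weak-dual formulation converge absolutely, and Fubini's theorem turns it
into the integral equation `u = 𝔾[u^p] + λ𝔾[μ]` almost everywhere (`isNonnegSolution_iff`). The
Picard iteration of this equation from `0` increases and stays below every supersolution
(`picardLimit_eq`, `picardLimit_le`). A solution `v` for some `λ' > λ` is a supersolution, so the
limit `u` is finite almost everywhere and is the minimal solution.

For stability put `V = p u^{p-1}` and `w = v - u`. Convexity of `t ↦ t^p` gives
`w ≥ 𝔾[V w] + (λ' - λ)𝔾[μ] > 𝔾[V w]`: the difference is a positive strict supersolution of the
linearized equation. Schur's test for the symmetric kernel `G` with the weight `V w`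
(`two_mul_kernelForm_le`) gives `∬ G |Vξ| |Vξ| ≤ ∫ V ξ² 𝔾[V w] / w`. On the other hand
`(∫ f ξ)² ≤ (∬ G |f| |f|) 𝓑(ξ, ξ)` for every `f ∈ L²(Ω)` and `ξ` in the form domain
(`ofReal_inner_sq_le`): for a test function `f` this is the Cauchy-Schwarz inequality for `𝓑`
applied to `𝔾[f]` and `ξ`, and the general case follows by density. With `f = V ξ`, after a
truncation of `V`, the two estimates give
`(∫ V ξ²)² ≤ (∫ V ξ² 𝔾[V w] / w) 𝓑(ξ, ξ)`, and the first factor is strictly smaller than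
`∫ V ξ²` when `ξ ≠ 0` (`lintegral_mul_sq_lt_closedForm`).
-/

/-! ### The distance to the boundary and Riesz type kernels -/

namespace SemilinearGreen

variable {N : ℕ} {Ω : Opens (Space N)} {s γ : ℝ}

theorem bdist_pos (hN : 0 < N) (hΩ : IsBoundedC2Domain Ω) {x : Space N} (hx : x ∈ Ω) :
    0 < bdist Ω x := by
  have : NeZero N := ⟨hN.ne'⟩
  have hne : (frontier (Ω : Set (Space N))).Nonempty := by
    rw [nonempty_iff_ne_empty, Ne, ← isClopen_iff_frontier_eq_empty]
    intro h
    have huniv := h.eq_univ ⟨x, hx⟩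
    have hb := hΩ.bounded
    rw [huniv] at hb
    exact NormedSpace.unbounded_univ ℝ (Space N) hb
  refine (Metric.infDist_pos_iff_notMem_closure hne).1 ?_
  rw [isClosed_frontier.closure_eq, Ω.isOpen.frontier_eq]
  exact fun h => h.2 hx

theorem bdist_nonneg (x : Space N) : 0 ≤ bdist Ω x := Metric.infDist_nonneg

theorem continuous_bdist : Continuous (bdist Ω) := Metric.continuous_infDist_pt _

theorem exists_bdist_le (hΩ : IsBoundedC2Domain Ω) : ∃ D > 0, ∀ x ∈ Ω, bdist Ω x ≤ D := by
  obtain ⟨x₀, hx₀⟩ := hΩ.connected.nonempty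
  obtain ⟨R, hR, h⟩ := hΩ.bounded.exists_pos_norm_le
  refine ⟨bdist Ω x₀ + 2 * R, by have := bdist_nonneg (Ω := Ω) x₀; positivity, fun x hx => ?_⟩
  have h1 : bdist Ω x ≤ bdist Ω x₀ + dist x x₀ := Metric.infDist_le_infDist_add_dist
  have h2 : dist x x₀ ≤ ‖x‖ + ‖x₀‖ := dist_le_norm_add_norm _ _
  linarith [h x hx, h x₀ hx₀]

theorem isFiniteMeasure_vol (hΩ : IsBoundedC2Domain Ω) : IsFiniteMeasure (vol Ω) :=
  ⟨by rw [Measure.restrict_apply_univ]; exact hΩ.bounded.measure_lt_top⟩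

/-- The weakly singular kernel `|x - y|^{-β}`, `β < N`, has uniformly bounded integrals over a
bounded set. -/
theorem exists_lintegral_riesz_le (hN : 0 < N) (hΩ : IsBoundedC2Domain Ω) {β : ℝ}
    (hβ : β < N) :
    ∃ A : ENNReal, A ≠ ⊤ ∧ ∀ x ∈ Ω, ∫⁻ y, ENNReal.ofReal (1 / ‖x - y‖ ^ β) ∂vol Ω ≤ A := by
  have : NeZero N := ⟨hN.ne'⟩
  obtain ⟨R, hR, h⟩ := hΩ.bounded.exists_pos_norm_le
  let f : ℝ → ℝ := (Ioo 0 (2 * R + 1)).indicator fun r => r ^ (-β)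
  have hint : Integrable (fun z : Space N => f ‖z‖) volume := by
    rw [integrable_fun_norm_addHaar]
    have h1 : IntegrableOn (fun r : ℝ => r ^ ((N : ℝ) - 1 - β)) (Ioo 0 (2 * R + 1)) volume :=
      (intervalIntegral.integrableOn_Ioo_rpow_iff (by positivity)).2 (by linarith)
    have h2 := (integrable_indicator_iff measurableSet_Ioo).2 h1
    refine (h2.congr (Eventually.of_forall fun r => ?_)).integrableOn
    simp only [f, smul_eq_mul, finrank_euclideanSpace, Fintype.card_fin]
    by_cases hr : r ∈ Ioo 0 (2 * R + 1)
    · rw [indicator_of_mem hr, indicator_of_mem hr, ← Real.rpow_natCast, ← Real.rpow_add hr.1,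
        Nat.cast_sub hN]
      congr 1
      push_cast
      ring
    · rw [indicator_of_notMem hr, indicator_of_notMem hr, mul_zero]
  refine ⟨∫⁻ z : Space N, ENNReal.ofReal (f ‖z‖), ?_, fun x hx => ?_⟩
  · exact hint.lintegral_lt_top.ne
  · rw [← lintegral_sub_left_eq_self (μ := (volume : Measure (Space N)))
      (fun z => ENNReal.ofReal (f ‖z‖)) x]
    refine le_trans (lintegral_mono_ae ?_) (lintegral_mono' Measure.restrict_le_self le_rfl)
    have hx0 : ∀ᵐ y ∂(vol Ω), y ≠ x :=
      ae_restrict_of_ae (by simp [ae_iff, measure_singleton])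
    filter_upwards [hx0, ae_restrict_mem Ω.isOpen.measurableSet] with y hy hyΩ
    have hr : ‖x - y‖ ∈ Ioo 0 (2 * R + 1) := by
      refine ⟨norm_pos_iff.2 (sub_ne_zero.2 (Ne.symm hy)), ?_⟩
      have := norm_sub_le x y
      linarith [h x hx, h y hyΩ]
    simp only [f, indicator_of_mem hr, Real.rpow_neg (norm_nonneg _), one_div, le_refl]

theorem modelKernel_nonneg (x y : Space N) : 0 ≤ modelKernel Ω s γ x y := by
  have h0 : ∀ z : Space N, 0 ≤ min (bdist Ω z / ‖x - y‖) 1 := fun z =>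
    le_min (div_nonneg (bdist_nonneg z) (norm_nonneg _)) zero_le_one
  exact mul_nonneg (mul_nonneg (by positivity) (Real.rpow_nonneg (h0 x) _))
    (Real.rpow_nonneg (h0 y) _)

theorem modelKernel_le (hγ : 0 < γ) {x y : Space N} :
    modelKernel Ω s γ x y ≤ 1 / ‖x - y‖ ^ ((N : ℝ) - 2 * s) := by
  have h0 : ∀ z : Space N, 0 ≤ min (bdist Ω z / ‖x - y‖) 1 := fun z =>
    le_min (div_nonneg (bdist_nonneg z) (norm_nonneg _)) zero_le_one
  have h1 : ∀ z : Space N, min (bdist Ω z / ‖x - y‖) 1 ^ γ ≤ 1 := fun z =>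
    Real.rpow_le_one (h0 z) (min_le_right _ _) hγ.le
  have hp : 0 ≤ 1 / ‖x - y‖ ^ ((N : ℝ) - 2 * s) := by positivity
  rw [modelKernel, mul_assoc]
  exact mul_le_of_le_one_right hp (mul_le_one₀ (h1 x) (Real.rpow_nonneg (h0 y) _) (h1 y))

/-- The model kernel maps `δ^γ` to a multiple of `δ^γ`. If `|x - y| ≥ δ(x)`, the factor
`δ(x)/|x-y|` absorbs `δ(y) ≤ 2|x - y|`; otherwise `δ(y) ≤ 2δ(x)`. -/
theorem modelKernel_mul_le (hγ : 0 < γ) {x y : Space N} (hxy : x ≠ y) :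
    modelKernel Ω s γ x y * bdist Ω y ^ γ ≤
      (2 ^ γ * bdist Ω x ^ γ) * (1 / ‖x - y‖ ^ ((N : ℝ) - 2 * s)) := by
  set r := ‖x - y‖ with hr
  have hr0 : 0 < r := norm_pos_iff.2 (sub_ne_zero.2 hxy)
  have hdx := bdist_nonneg (Ω := Ω) x
  have hdy := bdist_nonneg (Ω := Ω) y
  have h0 : ∀ z : Space N, 0 ≤ min (bdist Ω z / r) 1 := fun z =>
    le_min (div_nonneg (bdist_nonneg z) (norm_nonneg _)) zero_le_one
  have h1 : min (bdist Ω y / r) 1 ^ γ ≤ 1 := Real.rpow_le_one (h0 y) (min_le_right _ _) hγ.le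
  have hlip : bdist Ω y ≤ bdist Ω x + r := by
    have : bdist Ω y ≤ bdist Ω x + dist y x := Metric.infDist_le_infDist_add_dist
    rwa [dist_comm, dist_eq_norm] at this
  have h2 : min (bdist Ω x / r) 1 * bdist Ω y ≤ 2 * bdist Ω x := by
    rcases le_total (bdist Ω x) r with h | h
    · calc min (bdist Ω x / r) 1 * bdist Ω y ≤ bdist Ω x / r * (2 * r) :=
            mul_le_mul (min_le_left _ _) (by linarith) hdy (by positivity)
        _ = 2 * bdist Ω x := by field_simp
    · calc min (bdist Ω x / r) 1 * bdist Ω y ≤ 1 * (2 * bdist Ω x) :=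
            mul_le_mul (min_le_right _ _) (by linarith) hdy zero_le_one
        _ = 2 * bdist Ω x := one_mul _
  have h3 : min (bdist Ω x / r) 1 ^ γ * bdist Ω y ^ γ ≤ 2 ^ γ * bdist Ω x ^ γ := by
    rw [← Real.mul_rpow (h0 x) hdy, ← Real.mul_rpow zero_le_two hdx]
    exact Real.rpow_le_rpow (mul_nonneg (h0 x) hdy) h2 hγ.le
  have hp : 0 ≤ 1 / r ^ ((N : ℝ) - 2 * s) := by positivity
  have e : modelKernel Ω s γ x y * bdist Ω y ^ γ =
      (min (bdist Ω x / r) 1 ^ γ * bdist Ω y ^ γ) * (1 / r ^ ((N : ℝ) - 2 * s)) *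
        min (bdist Ω y / r) 1 ^ γ := by
    rw [modelKernel, ← hr]
    ring
  rw [e]
  refine (mul_le_of_le_one_right ?_ h1).trans (mul_le_mul_of_nonneg_right h3 hp)
  exact mul_nonneg (mul_nonneg (Real.rpow_nonneg (h0 x) _) (Real.rpow_nonneg hdy _)) hp

/-! ### The Green kernel with values in `[0, ∞]` -/

/-- The Green kernel as a function on the whole product with values in `[0, ∞]`, set to zero on
the diagonal and outside `Ω × Ω`. -/
noncomputable def greenKernel (Ω : Opens (Space N)) (G : Space N → Space N → ℝ) :
    Space N × Space N → ENNReal :=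
  (offDiag Ω).indicator fun z => ENNReal.ofReal (G z.1 z.2)

variable {L : 𝓓(Ω, ℝ) →ₗ[ℝ] L2 Ω} {G : Space N → Space N → ℝ}

theorem measurable_greenKernel (hG : IsGreenKernel Ω s γ L G) :
    Measurable (greenKernel Ω G) := by
  have e : greenKernel Ω G =
      fun z => ENNReal.ofReal ((offDiag Ω).indicator (fun z => G z.1 z.2) z) := by
    funext z
    by_cases hz : z ∈ offDiag Ω
    · simp [greenKernel, hz]
    · simp [greenKernel, hz]
  rw [e]
  exact hG.measurable.ennreal_ofReal

theorem greenKernel_of_ne {x y : Space N} (hx : x ∈ Ω) (hy : y ∈ Ω) (h : x ≠ y) :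
    greenKernel Ω G (x, y) = ENNReal.ofReal (G x y) :=
  indicator_of_mem (s := offDiag Ω) ⟨hx, hy, h⟩ _

theorem greenKernel_of_not {x y : Space N} (h : ¬(x ∈ Ω ∧ y ∈ Ω ∧ x ≠ y)) :
    greenKernel Ω G (x, y) = 0 :=
  indicator_of_notMem (s := offDiag Ω) h _

theorem greenKernel_symm (hG : IsGreenKernel Ω s γ L G) (x y : Space N) :
    greenKernel Ω G (x, y) = greenKernel Ω G (y, x) := by
  by_cases h : x ∈ Ω ∧ y ∈ Ω ∧ x ≠ y
  · rw [greenKernel_of_ne h.1 h.2.1 h.2.2, greenKernel_of_ne h.2.1 h.1 h.2.2.symm,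
      hG.symm x h.1 y h.2.1 h.2.2]
  · rw [greenKernel_of_not h, greenKernel_of_not fun h' => h ⟨h'.2.1, h'.1, h'.2.2.symm⟩]

theorem greenKernel_ne_top (z : Space N × Space N) : greenKernel Ω G z ≠ ⊤ := by
  by_cases hz : z ∈ offDiag Ω
  · simp [greenKernel, hz]
  · simp [greenKernel, hz]

/-- The integral operator with the Green kernel maps bounded functions to bounded functions and
`δ^γ` to a multiple of `δ^γ`. -/
theorem exists_greenKernel_bound (hN : 0 < N) (hΩ : IsBoundedC2Domain Ω)
    (hK : AdmissibleExponents N s γ) (hG : IsGreenKernel Ω s γ L G) :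
    ∃ A : ENNReal, A ≠ ⊤ ∧ (∀ x, ∫⁻ y, greenKernel Ω G (x, y) ∂vol Ω ≤ A) ∧
      ∀ x, ∫⁻ y, greenKernel Ω G (x, y) * ENNReal.ofReal (bdist Ω y ^ γ) ∂vol Ω ≤
        A * ENNReal.ofReal (bdist Ω x ^ γ) := by
  obtain ⟨c, -, C, hC, hest⟩ := hG.estimate
  have hsp := hK.s_pos
  obtain ⟨A, hA, hR⟩ := exists_lintegral_riesz_le hN hΩ (β := (N : ℝ) - 2 * s) (by linarith)
  have h2 : (1 : ℝ) ≤ 2 ^ γ := Real.one_le_rpow one_le_two hK.γ_pos.le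
  refine ⟨ENNReal.ofReal (C * 2 ^ γ) * A, by finiteness, fun x => ?_, fun x => ?_⟩
  · by_cases hx : x ∈ Ω
    · calc ∫⁻ y, greenKernel Ω G (x, y) ∂vol Ω
          ≤ ∫⁻ y, ENNReal.ofReal (C * 2 ^ γ) *
              ENNReal.ofReal (1 / ‖x - y‖ ^ ((N : ℝ) - 2 * s)) ∂vol Ω := by
            refine lintegral_mono fun y => ?_
            by_cases h : x ∈ Ω ∧ y ∈ Ω ∧ x ≠ y
            · rw [greenKernel_of_ne h.1 h.2.1 h.2.2, ← ENNReal.ofReal_mul (by positivity)]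
              refine ENNReal.ofReal_le_ofReal ((hest x h.1 y h.2.1 h.2.2).2.trans ?_)
              exact mul_le_mul (le_mul_of_one_le_right hC.le h2) (modelKernel_le hK.γ_pos)
                (modelKernel_nonneg x y) (by positivity)
            · rw [greenKernel_of_not h]
              exact zero_le
        _ ≤ ENNReal.ofReal (C * 2 ^ γ) * A := by
            rw [lintegral_const_mul' _ _ ENNReal.ofReal_ne_top]
            gcongr
            exact hR x hx
    · refine le_trans (le_of_eq ?_) zero_le
      rw [← lintegral_zero (μ := vol Ω)]
      exact lintegral_congr fun y => greenKernel_of_not fun h => hx h.1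
  · by_cases hx : x ∈ Ω
    · calc ∫⁻ y, greenKernel Ω G (x, y) * ENNReal.ofReal (bdist Ω y ^ γ) ∂vol Ω
          ≤ ∫⁻ y, ENNReal.ofReal (C * 2 ^ γ) * ENNReal.ofReal (bdist Ω x ^ γ) *
              ENNReal.ofReal (1 / ‖x - y‖ ^ ((N : ℝ) - 2 * s)) ∂vol Ω := by
            refine lintegral_mono fun y => ?_
            by_cases h : x ∈ Ω ∧ y ∈ Ω ∧ x ≠ y
            · have hb : 0 ≤ bdist Ω y ^ γ := Real.rpow_nonneg (bdist_nonneg y) _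
              have hb' : 0 ≤ bdist Ω x ^ γ := Real.rpow_nonneg (bdist_nonneg x) _
              rw [greenKernel_of_ne h.1 h.2.1 h.2.2,
                ← ENNReal.ofReal_mul (hG.pos x h.1 y h.2.1 h.2.2).le,
                ← ENNReal.ofReal_mul (by positivity), ← ENNReal.ofReal_mul (by positivity)]
              refine ENNReal.ofReal_le_ofReal ?_
              calc G x y * bdist Ω y ^ γ ≤ C * modelKernel Ω s γ x y * bdist Ω y ^ γ :=
                    mul_le_mul_of_nonneg_right (hest x h.1 y h.2.1 h.2.2).2 hb
                _ = C * (modelKernel Ω s γ x y * bdist Ω y ^ γ) := mul_assoc _ _ _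
                _ ≤ C * ((2 ^ γ * bdist Ω x ^ γ) * (1 / ‖x - y‖ ^ ((N : ℝ) - 2 * s))) :=
                    mul_le_mul_of_nonneg_left (modelKernel_mul_le hK.γ_pos h.2.2) hC.le
                _ = _ := by ring
            · rw [greenKernel_of_not h, zero_mul]
              exact zero_le
        _ ≤ ENNReal.ofReal (C * 2 ^ γ) * A * ENNReal.ofReal (bdist Ω x ^ γ) := by
            rw [lintegral_const_mul' _ _ (by finiteness), mul_right_comm]
            gcongr
            exact hR x hx
    · refine le_trans (le_of_eq ?_) zero_le
      rw [← lintegral_zero (μ := vol Ω)]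
      exact lintegral_congr fun y => by rw [greenKernel_of_not fun h => hx h.1, zero_mul]

end SemilinearGreen

/-! ### Potentials of nonnegative kernels: Schur's test and monotone iteration -/

namespace SemilinearGreen

section Abstract

variable {X : Type*} [MeasurableSpace X] {K : X × X → ENNReal} {ν : Measure X}

/-- The potential `x ↦ ∫ K(x,y) f(y) dν(y)` of a nonnegative function `f`. -/
noncomputable def potential (K : X × X → ENNReal) (ν : Measure X) (f : X → ENNReal) (x : X) :
    ENNReal :=
  ∫⁻ y, K (x, y) * f y ∂ν

theorem measurable_potential [SFinite ν] (hK : Measurable K) {f : X → ENNReal}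
    (hf : Measurable f) : Measurable (potential K ν f) :=
  (hK.mul (hf.comp measurable_snd)).lintegral_prod_right'

theorem potential_mono_ae {f g : X → ENNReal} (h : ∀ᵐ y ∂ν, f y ≤ g y) (x : X) :
    potential K ν f x ≤ potential K ν g x :=
  lintegral_mono_ae (h.mono fun _ hy => mul_le_mul_right hy _)

theorem potential_congr_ae {f g : X → ENNReal} (h : f =ᵐ[ν] g) (x : X) :
    potential K ν f x = potential K ν g x :=
  lintegral_congr_ae (h.mono fun y hy => by simp only [hy])

theorem potential_add (hK : Measurable K) {f g : X → ENNReal} (hf : Measurable f) (x : X) :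
    potential K ν (fun y => f y + g y) x = potential K ν f x + potential K ν g x := by
  unfold potential
  simp only [mul_add]
  exact lintegral_add_left ((hK.comp measurable_prodMk_left).mul hf) _

/-- The weighted arithmetic-geometric inequality behind Schur's test. -/
theorem two_mul_mul_le_div_mul_add (a b : ENNReal) {c d : ENNReal} (hc : c ≠ 0) (hc' : c ≠ ⊤)
    (hd : d ≠ 0) (hd' : d ≠ ⊤) :
    2 * (a * b) ≤ a ^ 2 / c * d + b ^ 2 / d * c := by
  rcases eq_or_ne a ⊤ with rfl | ha
  · have : (⊤ : ENNReal) ^ 2 / c * d = ⊤ := by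
      simp [ENNReal.top_div_of_ne_top hc', ENNReal.top_mul hd]
    rw [this, top_add]
    exact le_top
  rcases eq_or_ne b ⊤ with rfl | hb
  · have : (⊤ : ENNReal) ^ 2 / d * c = ⊤ := by
      simp [ENNReal.top_div_of_ne_top hd', ENNReal.top_mul hc]
    rw [this, add_top]
    exact le_top
  have hcp := ENNReal.toReal_pos hc hc'
  have hdp := ENNReal.toReal_pos hd hd'
  have h1 : a ^ 2 / c * d ≠ ⊤ :=
    ENNReal.mul_ne_top (ENNReal.div_ne_top (ENNReal.pow_ne_top ha) hc) hd'
  have h2 : b ^ 2 / d * c ≠ ⊤ :=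
    ENNReal.mul_ne_top (ENNReal.div_ne_top (ENNReal.pow_ne_top hb) hd) hc'
  rw [← ENNReal.toReal_le_toReal (by finiteness) (ENNReal.add_ne_top.2 ⟨h1, h2⟩),
    ENNReal.toReal_add h1 h2]
  simp only [ENNReal.toReal_mul, ENNReal.toReal_div, ENNReal.toReal_pow, ENNReal.toReal_ofNat]
  set a' := a.toReal
  set b' := b.toReal
  set c' := c.toReal
  set d' := d.toReal
  have e : a' ^ 2 / c' * d' + b' ^ 2 / d' * c' - 2 * (a' * b') =
      (a' * d' - b' * c') ^ 2 / (c' * d') := by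
    field_simp
    ring
  have : 0 ≤ (a' * d' - b' * c') ^ 2 / (c' * d') := by positivity
  linarith

/-- The bilinear form `∬ K(x,y) a(x) b(y)` of a nonnegative kernel on nonnegative functions. -/
noncomputable def kernelForm (K : X × X → ENNReal) (ν : Measure X) (a b : X → ENNReal) :
    ENNReal :=
  ∫⁻ x, a x * potential K ν b x ∂ν

theorem kernelForm_comm [SFinite ν] (hK : Measurable K) (hs : ∀ x y, K (x, y) = K (y, x))
    {a b : X → ENNReal} (ha : Measurable a) (hb : Measurable b) :
    kernelForm K ν a b = kernelForm K ν b a := by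
  have key : ∀ f g : X → ENNReal, Measurable f → Measurable g →
      kernelForm K ν f g = ∫⁻ x, ∫⁻ y, f x * (K (x, y) * g y) ∂ν ∂ν := fun f g hf hg =>
    lintegral_congr fun x => (lintegral_const_mul _
      ((hK.comp measurable_prodMk_left).mul hg)).symm
  rw [key a b ha hb, key b a hb ha, lintegral_lintegral_swap]
  · refine lintegral_congr fun y => lintegral_congr fun x => ?_
    rw [hs x y]
    ring
  · exact ((ha.comp measurable_fst).mul (hK.mul (hb.comp measurable_snd))).aemeasurable

theorem kernelForm_add_left {a b c : X → ENNReal} [SFinite ν] (hK : Measurable K)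
    (ha : Measurable a) (hc : Measurable c) :
    kernelForm K ν (fun x => a x + b x) c = kernelForm K ν a c + kernelForm K ν b c := by
  unfold kernelForm
  simp only [add_mul]
  exact lintegral_add_left (ha.mul (measurable_potential hK hc)) _

theorem kernelForm_mono {a b : X → ENNReal} (h : ∀ᵐ x ∂ν, a x ≤ b x) :
    kernelForm K ν a a ≤ kernelForm K ν b b :=
  lintegral_mono_ae (h.mono fun x hx => mul_le_mul' hx (potential_mono_ae h x))

/-- **Schur's test** for a symmetric kernel, in bilinear form and with an arbitrary weight `h`. -/
theorem two_mul_kernelForm_le [SFinite ν] (hK : Measurable K) (hs : ∀ x y, K (x, y) = K (y, x))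
    {a b h : X → ENNReal} (ha : Measurable a) (hb : Measurable b) (hh : Measurable h)
    (h0 : ∀ᵐ x ∂ν, h x ≠ 0) (htop : ∀ᵐ x ∂ν, h x ≠ ⊤) :
    2 * kernelForm K ν a b ≤
      ∫⁻ x, a x ^ 2 / h x * potential K ν h x ∂ν + ∫⁻ x, b x ^ 2 / h x * potential K ν h x ∂ν := by
  have e2 : ∫⁻ x, b x ^ 2 / h x * potential K ν h x ∂ν =
      ∫⁻ x, h x * potential K ν (fun y => b y ^ 2 / h y) x ∂ν :=
    kernelForm_comm hK hs ((hb.pow_const 2).div hh) hh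
  have hm : Measurable fun x => a x ^ 2 / h x * potential K ν h x :=
    ((ha.pow_const 2).div hh).mul (measurable_potential hK hh)
  have hm' : Measurable fun x => a x * potential K ν b x :=
    ha.mul (measurable_potential hK hb)
  rw [e2, ← lintegral_add_left hm, kernelForm,
    ← lintegral_const_mul _ hm']
  refine lintegral_mono_ae ?_
  filter_upwards [h0, htop] with x hx0 hxt
  have hKx : Measurable fun y => K (x, y) := hK.comp measurable_prodMk_left
  have hm1 : Measurable fun y => K (x, y) * b y := hKx.mul hb
  have hm2 : Measurable fun y => K (x, y) * h y := hKx.mul hh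
  have hm3 : Measurable fun y => K (x, y) * (b y ^ 2 / h y) := hKx.mul ((hb.pow_const 2).div hh)
  unfold potential
  rw [← mul_assoc, ← lintegral_const_mul _ hm1, ← lintegral_const_mul _ hm2,
    ← lintegral_const_mul _ hm3, ← lintegral_add_left (hm2.const_mul _)]
  refine lintegral_mono_ae ?_
  filter_upwards [h0, htop] with y hy0 hyt
  calc 2 * a x * (K (x, y) * b y) = K (x, y) * (2 * (a x * b y)) := by ring
    _ ≤ K (x, y) * (a x ^ 2 / h x * h y + b y ^ 2 / h y * h x) := by
        gcongr
        exact two_mul_mul_le_div_mul_add _ _ hx0 hxt hy0 hyt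
    _ = a x ^ 2 / h x * (K (x, y) * h y) + h x * (K (x, y) * (b y ^ 2 / h y)) := by ring

/-- The Picard iteration `u₀ = 0`, `u_{n+1} = K[u_n^p] + h`. -/
noncomputable def picard (K : X × X → ENNReal) (ν : Measure X) (h : X → ENNReal) (p : ℝ) :
    ℕ → X → ENNReal
  | 0 => fun _ => 0
  | n + 1 => fun x => potential K ν (fun y => picard K ν h p n y ^ p) x + h x

theorem measurable_picard [SFinite ν] (hK : Measurable K) {h : X → ENNReal} (hh : Measurable h)
    (p : ℝ) (n : ℕ) : Measurable (picard K ν h p n) := by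
  induction n with
  | zero => exact measurable_const
  | succ n ih => exact (measurable_potential hK (ih.pow_const p)).add hh

theorem picard_le_succ {h : X → ENNReal} {p : ℝ} (hp : 0 ≤ p) (n : ℕ) (x : X) :
    picard K ν h p n x ≤ picard K ν h p (n + 1) x := by
  induction n generalizing x with
  | zero => exact zero_le
  | succ n ih =>
    exact add_le_add_left (potential_mono_ae
      (Eventually.of_forall fun y => ENNReal.rpow_le_rpow (ih y) hp) x) _

/-- The limit of the Picard iteration. -/
noncomputable def picardLimit (K : X × X → ENNReal) (ν : Measure X) (h : X → ENNReal) (p : ℝ)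
    (x : X) : ENNReal :=
  ⨆ n, picard K ν h p n x

theorem measurable_picardLimit [SFinite ν] (hK : Measurable K) {h : X → ENNReal}
    (hh : Measurable h) (p : ℝ) : Measurable (picardLimit K ν h p) :=
  Measurable.iSup fun n => measurable_picard hK hh p n

theorem picardLimit_eq [SFinite ν] (hK : Measurable K) {h : X → ENNReal} (hh : Measurable h)
    {p : ℝ} (hp : 0 < p) (x : X) :
    picardLimit K ν h p x = potential K ν (fun y => picardLimit K ν h p y ^ p) x + h x := by
  have hmono : ∀ y, Monotone fun n => picard K ν h p n y := fun y =>
    monotone_nat_of_le_succ fun n => picard_le_succ hp.le n y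
  have hpow : ∀ y, picardLimit K ν h p y ^ p = ⨆ n, picard K ν h p n y ^ p := fun y =>
    (ENNReal.orderIsoRpow p hp).map_iSup _
  have e1 : potential K ν (fun y => picardLimit K ν h p y ^ p) x =
      ⨆ n, potential K ν (fun y => picard K ν h p n y ^ p) x := by
    unfold potential
    simp only [hpow, ENNReal.mul_iSup]
    refine lintegral_iSup (fun n => (hK.comp measurable_prodMk_left).mul
      ((measurable_picard hK hh p n).pow_const p)) fun m n hmn y => ?_
    exact mul_le_mul_right (ENNReal.rpow_le_rpow (hmono y hmn) hp.le) _
  rw [e1, ENNReal.iSup_add, picardLimit, ← (hmono x).iSup_nat_add 1]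
  rfl

/-- The limit of the Picard iteration lies below every supersolution. -/
theorem picardLimit_le {h : X → ENNReal} {p : ℝ} (hp : 0 ≤ p) {v : X → ENNReal}
    (hv : ∀ᵐ x ∂ν, potential K ν (fun y => v y ^ p) x + h x ≤ v x) :
    ∀ᵐ x ∂ν, picardLimit K ν h p x ≤ v x := by
  have key : ∀ n, ∀ᵐ x ∂ν, picard K ν h p n x ≤ v x := by
    intro n
    induction n with
    | zero => exact Eventually.of_forall fun x => zero_le
    | succ n ih =>
      filter_upwards [hv] with x hx
      refine le_trans (add_le_add_left (potential_mono_ae ?_ x) _) hx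
      exact ih.mono fun y hy => ENNReal.rpow_le_rpow hy hp
  filter_upwards [ae_all_iff.2 key] with x hx using iSup_le hx

end Abstract

/-- The tangent line inequality for the convex function `t ↦ t ^ p`. -/
theorem rpow_add_mul_le_add_rpow {p : ℝ} (hp : 1 < p) {u w : ENNReal} (hu : u ≠ ⊤) :
    u ^ p + ENNReal.ofReal p * u ^ (p - 1) * w ≤ (u + w) ^ p := by
  rcases eq_or_ne w ⊤ with rfl | hw
  · simp [ENNReal.top_rpow_of_pos (zero_lt_one.trans hp)]
  rcases eq_or_ne u 0 with rfl | hu0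
  · simp [ENNReal.zero_rpow_of_pos (zero_lt_one.trans hp), ENNReal.zero_rpow_of_pos (sub_pos.2 hp)]
  lift u to NNReal using hu
  lift w to NNReal using hw
  have hu1 : (0 : ℝ) < u := by
    have : u ≠ 0 := by simpa using hu0
    positivity
  have hw1 : (0 : ℝ) ≤ w := w.2
  have key : (u : ℝ) ^ p + p * (u : ℝ) ^ (p - 1) * w ≤ ((u : ℝ) + w) ^ p := by
    have b := one_add_mul_self_le_rpow_one_add (s := (w : ℝ) / u) (by
      have : 0 ≤ (w : ℝ) / u := by positivity
      linarith) hp.le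
    have e1 : ((u : ℝ) + w) ^ p = (u : ℝ) ^ p * (1 + w / u) ^ p := by
      rw [← Real.mul_rpow hu1.le (by positivity)]
      congr 1
      field_simp
    have e2 : (u : ℝ) ^ p + p * (u : ℝ) ^ (p - 1) * w = (u : ℝ) ^ p * (1 + p * (w / u)) := by
      rw [Real.rpow_sub_one hu1.ne']
      field_simp
    rw [e1, e2]
    exact mul_le_mul_of_nonneg_left b (by positivity)
  have hp0 : 0 ≤ p := by linarith
  have hp1 : 0 ≤ p - 1 := by linarith
  rw [← ENNReal.coe_rpow_of_nonneg _ hp0, ← ENNReal.coe_rpow_of_nonneg _ hp1, ← ENNReal.coe_add,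
    ← ENNReal.coe_rpow_of_nonneg _ hp0, ENNReal.ofReal]
  norm_cast
  rw [← NNReal.coe_le_coe]
  push_cast
  rwa [Real.coe_toNNReal _ hp0]

end SemilinearGreen

/-! ### Weak-dual solutions are the solutions of the integral equation -/

namespace SemilinearGreen

variable {N : ℕ} {Ω : Opens (Space N)} {s γ : ℝ}
variable {L : 𝓓(Ω, ℝ) →ₗ[ℝ] L2 Ω} {G : Space N → Space N → ℝ}

theorem greenOp_eq_integral (hN : 0 < N) (hG : IsGreenKernel Ω s γ L G) {x : Space N}
    (hx : x ∈ Ω) (ξ : Space N → ℝ) :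
    greenOp Ω G ξ x = ∫ y, (greenKernel Ω G (x, y)).toReal * ξ y ∂vol Ω := by
  have : NeZero N := ⟨hN.ne'⟩
  refine integral_congr_ae ?_
  have hx0 : ∀ᵐ y ∂(vol Ω), y ≠ x :=
    ae_restrict_of_ae (by simp [ae_iff, measure_singleton])
  filter_upwards [hx0, ae_restrict_mem Ω.isOpen.measurableSet] with y hy hyΩ
  rw [greenKernel_of_ne hx hyΩ (Ne.symm hy), ENNReal.toReal_ofReal (hG.pos x hx y hyΩ
    (Ne.symm hy)).le]

theorem ae_weight_pos (hN : 0 < N) (hΩ : IsBoundedC2Domain Ω) :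
    ∀ᵐ x ∂vol Ω, 0 < bdist Ω x ^ γ := by
  filter_upwards [ae_restrict_mem Ω.isOpen.measurableSet] with x hx
  exact Real.rpow_pos_of_pos (bdist_pos hN hΩ hx) _

theorem measurable_weight : Measurable fun x => bdist Ω x ^ γ :=
  continuous_bdist.measurable.pow_const _

theorem lintegral_weight_mul_potential_le (hG : IsGreenKernel Ω s γ L G) {A : ENNReal}
    (hA : ∀ x, ∫⁻ y, greenKernel Ω G (x, y) * ENNReal.ofReal (bdist Ω y ^ γ) ∂vol Ω ≤
      A * ENNReal.ofReal (bdist Ω x ^ γ))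
    {ν : Measure (Space N)} [SFinite ν] {f : Space N → ENNReal} (hf : AEMeasurable f ν) :
    ∫⁻ y, ENNReal.ofReal (bdist Ω y ^ γ) * potential (greenKernel Ω G) ν f y ∂vol Ω ≤
      A * ∫⁻ x, f x * ENNReal.ofReal (bdist Ω x ^ γ) ∂ν := by
  have hK := measurable_greenKernel hG
  have hw : Measurable fun x => ENNReal.ofReal (bdist Ω x ^ γ) := measurable_weight.ennreal_ofReal
  have hg : Measurable (hf.mk f) := hf.measurable_mk
  have e : ∫⁻ x, f x * ENNReal.ofReal (bdist Ω x ^ γ) ∂ν =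
      ∫⁻ x, hf.mk f x * ENNReal.ofReal (bdist Ω x ^ γ) ∂ν :=
    lintegral_congr_ae (hf.ae_eq_mk.mono fun x hx => by simp only [hx])
  have hgw : Measurable fun x => hf.mk f x * ENNReal.ofReal (bdist Ω x ^ γ) := hg.mul hw
  rw [e, ← lintegral_const_mul _ hgw]
  simp_rw [potential_congr_ae hf.ae_eq_mk]
  generalize hf.mk f = g at hg
  calc ∫⁻ y, ENNReal.ofReal (bdist Ω y ^ γ) * potential (greenKernel Ω G) ν g y ∂vol Ω
      = ∫⁻ y, ∫⁻ x, ENNReal.ofReal (bdist Ω y ^ γ) * (greenKernel Ω G (y, x) * g x) ∂ν ∂vol Ω := by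
        refine lintegral_congr fun y => (lintegral_const_mul _ ?_).symm
        exact (hK.comp measurable_prodMk_left).mul hg
    _ = ∫⁻ x, ∫⁻ y, ENNReal.ofReal (bdist Ω y ^ γ) * (greenKernel Ω G (y, x) * g x) ∂vol Ω ∂ν := by
        refine lintegral_lintegral_swap ?_
        exact ((hw.comp measurable_fst).mul (hK.mul (hg.comp measurable_snd))).aemeasurable
    _ ≤ ∫⁻ x, A * (g x * ENNReal.ofReal (bdist Ω x ^ γ)) ∂ν := by
        refine lintegral_mono fun x => ?_
        calc ∫⁻ y, ENNReal.ofReal (bdist Ω y ^ γ) * (greenKernel Ω G (y, x) * g x) ∂vol Ω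
            = ∫⁻ y, g x * (greenKernel Ω G (x, y) * ENNReal.ofReal (bdist Ω y ^ γ)) ∂vol Ω := by
              refine lintegral_congr fun y => ?_
              rw [greenKernel_symm hG y x]
              ring
          _ = g x * ∫⁻ y, greenKernel Ω G (x, y) * ENNReal.ofReal (bdist Ω y ^ γ) ∂vol Ω :=
              lintegral_const_mul _ ((hK.comp measurable_prodMk_left).mul hw)
          _ ≤ g x * (A * ENNReal.ofReal (bdist Ω x ^ γ)) := mul_le_mul_right (hA x) _
          _ = A * (g x * ENNReal.ofReal (bdist Ω x ^ γ)) := by ring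

theorem ae_potential_lt_top (hN : 0 < N) (hΩ : IsBoundedC2Domain Ω)
    (hE : AdmissibleExponents N s γ) (hG : IsGreenKernel Ω s γ L G)
    {ν : Measure (Space N)} [SFinite ν] {f : Space N → ENNReal} (hf : AEMeasurable f ν)
    (hfin : ∫⁻ x, f x * ENNReal.ofReal (bdist Ω x ^ γ) ∂ν ≠ ⊤) :
    ∀ᵐ y ∂vol Ω, potential (greenKernel Ω G) ν f y < ⊤ := by
  obtain ⟨A, hA, -, hAw⟩ := exists_greenKernel_bound hN hΩ hE hG
  have h := (lintegral_weight_mul_potential_le hG hAw hf).trans_lt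
    (ENNReal.mul_lt_top hA.lt_top hfin.lt_top)
  have hm : AEMeasurable (fun y => ENNReal.ofReal (bdist Ω y ^ γ) *
      potential (greenKernel Ω G) ν f y) (vol Ω) := by
    simp_rw [potential_congr_ae hf.ae_eq_mk]
    exact (measurable_weight.ennreal_ofReal.mul
      (measurable_potential (measurable_greenKernel hG) hf.measurable_mk)).aemeasurable
  filter_upwards [ae_lt_top' hm h.ne, ae_weight_pos (γ := γ) hN hΩ] with y hy hw
  by_contra hcon
  rw [not_lt_top_iff.1 hcon, ENNReal.mul_top (ENNReal.ofReal_pos.2 hw).ne'] at hy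
  exact lt_irrefl _ hy

/-- Symmetry of the Green operator: its adjoint is the potential. Both sides are absolutely
convergent because the Green operator maps `δ^γ L^∞` to itself. -/
theorem integral_mul_greenOp (hN : 0 < N) (hΩ : IsBoundedC2Domain Ω)
    (hE : AdmissibleExponents N s γ) (hG : IsGreenKernel Ω s γ L G)
    {ν : Measure (Space N)} [SFinite ν] (hν : ∀ᵐ x ∂ν, x ∈ Ω)
    {f : Space N → ENNReal} (hf : AEMeasurable f ν) (hft : ∀ᵐ x ∂ν, f x < ⊤)
    (hfin : ∫⁻ x, f x * ENNReal.ofReal (bdist Ω x ^ γ) ∂ν ≠ ⊤)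
    {ξ : Space N → ℝ} (hξ : MemWeightedLinfty Ω γ ξ) :
    Integrable (fun y => ξ y * (potential (greenKernel Ω G) ν f y).toReal) (vol Ω) ∧
      ∫ x, (f x).toReal * greenOp Ω G ξ x ∂ν =
        ∫ y, ξ y * (potential (greenKernel Ω G) ν f y).toReal ∂vol Ω := by
  obtain ⟨A, hA, -, hAw⟩ := exists_greenKernel_bound hN hΩ hE hG
  have hK := measurable_greenKernel hG
  obtain ⟨v, hv, hξv⟩ := hξ
  have hw : Measurable fun x => bdist Ω x ^ γ := measurable_weight
  have hξm : AEStronglyMeasurable ξ (vol Ω) :=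
    (hw.aestronglyMeasurable.mul hv.1).congr hξv.symm
  set c := eLpNorm v ⊤ (vol Ω) with hc
  have hξb : ∀ᵐ y ∂vol Ω, ‖ξ y‖ₑ ≤ c * ENNReal.ofReal (bdist Ω y ^ γ) := by
    filter_upwards [hξv, ae_le_eLpNormEssSup (f := v) (μ := vol Ω)] with y hy hvy
    rw [hy, enorm_mul, mul_comm, Real.enorm_of_nonneg (Real.rpow_nonneg (bdist_nonneg y) _), hc,
      eLpNorm_exponent_top]
    gcongr
  let F : Space N → Space N → ℝ := fun x y =>
    (f x).toReal * ((greenKernel Ω G (x, y)).toReal * ξ y)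
  have hFm : AEStronglyMeasurable (Function.uncurry F) (ν.prod (vol Ω)) :=
    (hf.ennreal_toReal.aestronglyMeasurable.comp_fst).mul
      (hK.ennreal_toReal.aestronglyMeasurable.mul hξm.comp_snd)
  have hFi : Integrable (Function.uncurry F) (ν.prod (vol Ω)) := by
    refine ⟨hFm, ?_⟩
    rw [hasFiniteIntegral_iff_enorm, lintegral_prod _ hFm.enorm]
    have hb : ∀ x, ∫⁻ y, ‖F x y‖ₑ ∂vol Ω ≤
        c * A * (f x * ENNReal.ofReal (bdist Ω x ^ γ)) := by
      intro x
      calc ∫⁻ y, ‖F x y‖ₑ ∂vol Ω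
          ≤ ∫⁻ y, (f x * c) * (greenKernel Ω G (x, y) *
              ENNReal.ofReal (bdist Ω y ^ γ)) ∂vol Ω := by
            refine lintegral_mono_ae ?_
            filter_upwards [hξb] with y hy
            have h1 : ‖(f x).toReal‖ₑ ≤ f x := by
              rw [Real.enorm_of_nonneg ENNReal.toReal_nonneg]
              exact ENNReal.ofReal_toReal_le
            have h2 : ‖(greenKernel Ω G (x, y)).toReal‖ₑ ≤ greenKernel Ω G (x, y) := by
              rw [Real.enorm_of_nonneg ENNReal.toReal_nonneg]
              exact ENNReal.ofReal_toReal_le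
            calc ‖F x y‖ₑ = ‖(f x).toReal‖ₑ * (‖(greenKernel Ω G (x, y)).toReal‖ₑ * ‖ξ y‖ₑ) := by
                  rw [enorm_mul, enorm_mul]
              _ ≤ f x * (greenKernel Ω G (x, y) * (c * ENNReal.ofReal (bdist Ω y ^ γ))) :=
                  mul_le_mul' h1 (mul_le_mul' h2 hy)
              _ = _ := by ring
        _ = (f x * c) * ∫⁻ y, greenKernel Ω G (x, y) *
              ENNReal.ofReal (bdist Ω y ^ γ) ∂vol Ω :=
            lintegral_const_mul _ ((hK.comp measurable_prodMk_left).mul hw.ennreal_ofReal)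
        _ ≤ (f x * c) * (A * ENNReal.ofReal (bdist Ω x ^ γ)) := mul_le_mul_right (hAw x) _
        _ = _ := by ring
    refine (lintegral_mono hb).trans_lt ?_
    have hm : AEMeasurable (fun x => f x * ENNReal.ofReal (bdist Ω x ^ γ)) ν :=
      hf.mul hw.ennreal_ofReal.aemeasurable
    rw [lintegral_const_mul'' _ hm]
    exact ENNReal.mul_lt_top (ENNReal.mul_lt_top hv.2 hA.lt_top) hfin.lt_top
  have hinner : ∀ y, ∫ x, F x y ∂ν = ξ y * (potential (greenKernel Ω G) ν f y).toReal := by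
    intro y
    have hm : AEMeasurable (fun x => greenKernel Ω G (y, x) * f x) ν :=
      (hK.comp measurable_prodMk_left).aemeasurable.mul hf
    rw [potential, ← integral_toReal hm
      (hft.mono fun x hx => ENNReal.mul_lt_top (greenKernel_ne_top _).lt_top hx),
      ← integral_const_mul]
    refine integral_congr_ae (Eventually.of_forall fun x => ?_)
    simp only [F, ENNReal.toReal_mul, greenKernel_symm hG y x]
    ring
  refine ⟨(hFi.integral_prod_right).congr (Eventually.of_forall hinner), ?_⟩
  rw [← integral_congr_ae (Eventually.of_forall hinner), ← integral_integral_swap hFi]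
  refine integral_congr_ae ?_
  filter_upwards [hν] with x hx
  rw [greenOp_eq_integral hN hG hx, ← integral_const_mul]

/-- The part in `Ω` of a normalized datum is s-finite, because its multiple by the positive
weight `δ^γ` is a finite measure. -/
theorem sFinite_datum (hN : 0 < N) (hΩ : IsBoundedC2Domain Ω) {μ : Measure (Space N)}
    (hμ : IsNormalizedDatum Ω γ μ) : SFinite (μ.restrict (Ω : Set (Space N))) := by
  have hw : Measurable fun x => ENNReal.ofReal (bdist Ω x ^ γ) := measurable_weight.ennreal_ofReal
  have hfin : IsFiniteMeasure ((μ.restrict (Ω : Set (Space N))).withDensity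
      fun x => ENNReal.ofReal (bdist Ω x ^ γ)) :=
    isFiniteMeasure_withDensity (by rw [hμ.2]; exact ENNReal.one_ne_top)
  rw [← withDensity_inv_same (μ := μ.restrict (Ω : Set (Space N))) hw ?_
    (Eventually.of_forall fun x => ENNReal.ofReal_ne_top)]
  · infer_instance
  · filter_upwards [ae_restrict_mem Ω.isOpen.measurableSet] with x hx
    exact (ENNReal.ofReal_pos.2 (Real.rpow_pos_of_pos (bdist_pos hN hΩ hx) _)).ne'

/-- The potential `𝔾[μ]` of the datum. -/
noncomputable def datumPotential (Ω : Opens (Space N)) (G : Space N → Space N → ℝ)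
    (μ : Measure (Space N)) : Space N → ENNReal :=
  potential (greenKernel Ω G) (μ.restrict (Ω : Set (Space N))) fun _ => 1

theorem measurable_datumPotential (hN : 0 < N) (hΩ : IsBoundedC2Domain Ω)
    (hG : IsGreenKernel Ω s γ L G) {μ : Measure (Space N)} (hμ : IsNormalizedDatum Ω γ μ) :
    Measurable (datumPotential Ω G μ) := by
  have := sFinite_datum hN hΩ hμ
  exact measurable_potential (measurable_greenKernel hG) measurable_const

/-- The potential of the datum is positive off a single point, since the datum is not zero and
the Green kernel is positive off the diagonal. -/
theorem ae_datumPotential_pos (hN : 0 < N) (hG : IsGreenKernel Ω s γ L G)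
    {μ : Measure (Space N)} (hμ : IsNormalizedDatum Ω γ μ) :
    ∀ᵐ x ∂vol Ω, 0 < datumPotential Ω G μ x := by
  have : NeZero N := ⟨hN.ne'⟩
  have hmem : ∀ᵐ y ∂μ.restrict (Ω : Set (Space N)), y ∈ Ω :=
    ae_restrict_mem Ω.isOpen.measurableSet
  have key : ∀ x ∈ Ω, datumPotential Ω G μ x = 0 →
      ∀ᵐ y ∂μ.restrict (Ω : Set (Space N)), y = x := by
    intro x hx h0
    have hm : Measurable fun y => greenKernel Ω G (x, y) * 1 :=
      ((measurable_greenKernel hG).comp measurable_prodMk_left).mul_const _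
    have h1 := (lintegral_eq_zero_iff hm).1 h0
    filter_upwards [h1, hmem] with y hy hyΩ
    by_contra hne
    have hp := hG.pos x hx y hyΩ (Ne.symm hne)
    simp only [mul_one, Pi.zero_apply, greenKernel_of_ne hx hyΩ (Ne.symm hne),
      ENNReal.ofReal_eq_zero] at hy
    linarith
  have hsub : {x | x ∈ Ω ∧ datumPotential Ω G μ x = 0}.Subsingleton := by
    rintro x ⟨hx, hx0⟩ z ⟨hz, hz0⟩
    by_contra hne
    have hfalse : ∀ᵐ y ∂μ.restrict (Ω : Set (Space N)), False := by
      filter_upwards [key x hx hx0, key z hz hz0] with y h1 h2 using hne (h1.symm.trans h2)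
    have hzero : μ.restrict (Ω : Set (Space N)) = 0 :=
      ae_eq_bot.1 (eventually_false_iff_eq_bot.1 hfalse)
    have h1 := hμ.2
    rw [hzero] at h1
    simp at h1
  have hnull : ∀ᵐ x ∂vol Ω, x ∉ {x | x ∈ Ω ∧ datumPotential Ω G μ x = 0} :=
    measure_eq_zero_iff_ae_notMem.1 (hsub.measure_zero _)
  filter_upwards [hnull, ae_restrict_mem Ω.isOpen.measurableSet] with x hx hxΩ
  exact pos_iff_ne_zero.2 fun h => hx ⟨hxΩ, h⟩

/-- A nonnegative function in `L^p(Ω, δ^γ)` is a weak-dual solution if and only if it solves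
`u = 𝔾[u^p] + λ𝔾[μ]` almost everywhere. -/
theorem isNonnegSolution_iff (hN : 0 < N) (hΩ : IsBoundedC2Domain Ω)
    (hE : AdmissibleExponents N s γ) (hG : IsGreenKernel Ω s γ L G) {p : ℝ} (hp : 1 < p)
    {μ : Measure (Space N)} (hμ : IsNormalizedDatum Ω γ μ) {lam : ℝ} (hlam : 0 < lam)
    {u : Space N → ℝ} :
    IsNonnegSolution Ω γ p G μ lam u ↔ (∀ᵐ x ∂vol Ω, 0 ≤ u x) ∧
      AEMeasurable u (vol Ω) ∧
      ∫⁻ x, ENNReal.ofReal (u x) ^ p * ENNReal.ofReal (bdist Ω x ^ γ) ∂vol Ω ≠ ⊤ ∧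
      ∀ᵐ x ∂vol Ω, ENNReal.ofReal (u x) =
        potential (greenKernel Ω G) (vol Ω) (fun y => ENNReal.ofReal (u y) ^ p) x +
          ENNReal.ofReal lam * datumPotential Ω G μ x := by
  have hp0 : 0 < p := by linarith
  have := sFinite_datum hN hΩ hμ
  have hfv := isFiniteMeasure_vol hΩ
  have hmem : ∀ᵐ x ∂vol Ω, x ∈ Ω := ae_restrict_mem Ω.isOpen.measurableSet
  have hmemμ : ∀ᵐ y ∂μ.restrict (Ω : Set (Space N)), y ∈ Ω :=
    ae_restrict_mem Ω.isOpen.measurableSet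
  have hw : Measurable fun x => bdist Ω x ^ γ := measurable_weight
  rw [IsNonnegSolution, and_congr_right_iff]
  intro hu0
  -- membership in the weighted space, in terms of `[0, ∞]`-valued integrals
  have hmemLp : MemWeightedLp Ω γ p u ↔ AEMeasurable u (vol Ω) ∧
      ∫⁻ x, ENNReal.ofReal (u x) ^ p * ENNReal.ofReal (bdist Ω x ^ γ) ∂vol Ω ≠ ⊤ := by
    rw [MemWeightedLp, aestronglyMeasurable_iff_aemeasurable, and_congr_right_iff]
    intro hum
    have e : ∫⁻ x, ENNReal.ofReal (u x) ^ p * ENNReal.ofReal (bdist Ω x ^ γ) ∂vol Ω =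
        ∫⁻ x, ENNReal.ofReal (|u x| ^ p * bdist Ω x ^ γ) ∂vol Ω := by
      refine lintegral_congr_ae ?_
      filter_upwards [hu0] with x hx
      rw [abs_of_nonneg hx, ENNReal.ofReal_mul (Real.rpow_nonneg hx _),
        ENNReal.ofReal_rpow_of_nonneg hx hp0.le]
    have hm : AEStronglyMeasurable (fun x => |u x| ^ p * bdist Ω x ^ γ) (vol Ω) :=
      (((continuous_abs.measurable.comp_aemeasurable hum).pow_const p).mul
        hw.aemeasurable).aestronglyMeasurable
    rw [e]
    refine ⟨fun h => h.lintegral_lt_top.ne, fun h => ⟨hm, ?_⟩⟩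
    rw [hasFiniteIntegral_iff_ofReal (Eventually.of_forall fun x =>
      mul_nonneg (Real.rpow_nonneg (abs_nonneg _) _) (Real.rpow_nonneg (bdist_nonneg x) _))]
    exact h.lt_top
  rw [IsWeakDualSolution, hmemLp, and_assoc, and_congr_right_iff]
  intro hum
  rw [and_congr_right_iff]
  intro hfin
  set f : Space N → ENNReal := fun x => ENNReal.ofReal (u x) ^ p with hf
  have hfm : AEMeasurable f (vol Ω) := hum.ennreal_ofReal.pow_const p
  have hft : ∀ᵐ x ∂vol Ω, f x < ⊤ := Eventually.of_forall fun x =>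
    ENNReal.rpow_lt_top_of_nonneg hp0.le ENNReal.ofReal_ne_top
  have hfinμ : ∫⁻ x, 1 * ENNReal.ofReal (bdist Ω x ^ γ) ∂μ.restrict (Ω : Set (Space N)) ≠ ⊤ := by
    simp only [one_mul]
    rw [hμ.2]
    exact ENNReal.one_ne_top
  set P₁ := potential (greenKernel Ω G) (vol Ω) f with hP₁
  set P₂ := datumPotential Ω G μ with hP₂
  have hP₁t : ∀ᵐ x ∂vol Ω, P₁ x < ⊤ := ae_potential_lt_top hN hΩ hE hG hfm hfin
  have hP₂t : ∀ᵐ x ∂vol Ω, P₂ x < ⊤ :=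
    ae_potential_lt_top hN hΩ hE hG aemeasurable_const hfinμ
  set U : Space N → ℝ := fun x => (P₁ x).toReal + lam * (P₂ x).toReal with hU
  -- the right-hand side of the weak-dual formulation
  have hrhs : ∀ ξ : Space N → ℝ, MemWeightedLinfty Ω γ ξ →
      Integrable (fun x => ξ x * U x) (vol Ω) ∧
      (∫ x in (Ω : Set (Space N)), u x ^ p * greenOp Ω G ξ x) +
        lam * ∫ x in (Ω : Set (Space N)), greenOp Ω G ξ x ∂μ = ∫ x, ξ x * U x ∂vol Ω := by
    intro ξ hξ
    obtain ⟨i₁, h₁⟩ := integral_mul_greenOp hN hΩ hE hG hmem hfm hft hfin hξ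
    obtain ⟨i₂, h₂⟩ := integral_mul_greenOp hN hΩ hE hG hmemμ aemeasurable_const
      (Eventually.of_forall fun _ => ENNReal.one_lt_top) hfinμ hξ
    rw [← hP₁] at i₁ h₁
    change Integrable (fun y => ξ y * (P₂ y).toReal) (vol Ω) at i₂
    change _ = ∫ y, ξ y * (P₂ y).toReal ∂vol Ω at h₂
    have e : (fun x => ξ x * U x) =
        fun x => ξ x * (P₁ x).toReal + lam * (ξ x * (P₂ x).toReal) := by
      funext x
      simp only [hU]
      ring
    rw [e]
    refine ⟨i₁.add (i₂.const_mul lam), ?_⟩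
    rw [integral_add i₁ (i₂.const_mul lam), integral_const_mul, ← h₂, ← h₁]
    simp only [ENNReal.toReal_one, one_mul]
    congr 1
    refine integral_congr_ae ?_
    filter_upwards [hu0] with x hx
    simp only [hf]
    rw [← ENNReal.toReal_rpow, ENNReal.toReal_ofReal hx]
  -- the integral equation, in real terms
  have heq : (∀ᵐ x ∂vol Ω, ENNReal.ofReal (u x) = P₁ x + ENNReal.ofReal lam * P₂ x) ↔
      ∀ᵐ x ∂vol Ω, u x = U x := by
    refine eventually_congr ?_
    filter_upwards [hu0, hP₁t, hP₂t] with x hx h1 h2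
    have h3 : ENNReal.ofReal lam * P₂ x ≠ ⊤ := ENNReal.mul_ne_top ENNReal.ofReal_ne_top h2.ne
    rw [← ENNReal.toReal_eq_toReal_iff' ENNReal.ofReal_ne_top (ENNReal.add_ne_top.2 ⟨h1.ne, h3⟩),
      ENNReal.toReal_add h1.ne h3, ENNReal.toReal_mul, ENNReal.toReal_ofReal hx,
      ENNReal.toReal_ofReal hlam.le]
  rw [heq]
  constructor
  · intro h
    -- test with `δ^γ` times indicator functions
    have htest : ∀ S : Set (Space N), MeasurableSet S →
        MemWeightedLinfty Ω γ (S.indicator fun x => bdist Ω x ^ γ) := by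
      intro S hS
      refine ⟨S.indicator fun _ => 1, (memLp_top_const 1).indicator hS, ?_⟩
      refine Eventually.of_forall fun x => ?_
      by_cases hx : x ∈ S <;> simp [hx]
    have hiU : Integrable (fun x => bdist Ω x ^ γ * U x) (vol Ω) := by
      simpa using (hrhs _ (htest univ MeasurableSet.univ)).1
    have hiu : Integrable (fun x => bdist Ω x ^ γ * u x) (vol Ω) := by
      obtain ⟨D, hD, hDb⟩ := exists_bdist_le hΩ
      have h1 := (hmemLp.2 ⟨hum, hfin⟩).2
      refine Integrable.mono' ((integrable_const (D ^ γ)).add h1)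
        (hw.aemeasurable.mul hum).aestronglyMeasurable ?_
      filter_upwards [hmem, hu0] with x hx hux
      have hd := Real.rpow_nonneg (bdist_nonneg (Ω := Ω) x) γ
      have hdD : bdist Ω x ^ γ ≤ D ^ γ :=
        Real.rpow_le_rpow (bdist_nonneg x) (hDb x hx) hE.γ_pos.le
      have hle : u x ≤ 1 + u x ^ p := by
        rcases le_total (u x) 1 with h1 | h1
        · have := Real.rpow_nonneg hux p
          linarith
        · have := Real.self_le_rpow_of_one_le h1 hp.le
          linarith
      simp only [Pi.add_apply]
      rw [Real.norm_of_nonneg (mul_nonneg hd hux), abs_of_nonneg hux]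
      nlinarith [mul_le_mul_of_nonneg_left hle hd]
    have hae := Integrable.ae_eq_of_forall_setIntegral_eq _ _ hiu hiU fun S hS _ => by
      have h1 := h _ (htest S hS)
      rw [(hrhs _ (htest S hS)).2] at h1
      rw [← integral_indicator hS, ← integral_indicator hS]
      calc ∫ x, S.indicator (fun x => bdist Ω x ^ γ * u x) x ∂vol Ω
          = ∫ x, u x * S.indicator (fun x => bdist Ω x ^ γ) x ∂vol Ω := by
            refine integral_congr_ae (Eventually.of_forall fun x => ?_)
            by_cases hx : x ∈ S <;> simp [hx, mul_comm]
        _ = ∫ x, S.indicator (fun x => bdist Ω x ^ γ) x * U x ∂vol Ω := h1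
        _ = ∫ x, S.indicator (fun x => bdist Ω x ^ γ * U x) x ∂vol Ω := by
            refine integral_congr_ae (Eventually.of_forall fun x => ?_)
            by_cases hx : x ∈ S <;> simp [hx]
    filter_upwards [hae, ae_weight_pos (γ := γ) hN hΩ] with x hx hwx
    exact mul_left_cancel₀ hwx.ne' hx
  · intro h ξ hξ
    rw [(hrhs ξ hξ).2]
    refine integral_congr_ae ?_
    filter_upwards [h] with x hx
    rw [hx, mul_comm]

end SemilinearGreen

/-! ### The energy inequality dual to the Green operator -/

namespace SemilinearGreen

variable {N : ℕ} {Ω : Opens (Space N)} {s γ : ℝ}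
variable {L : 𝓓(Ω, ℝ) →ₗ[ℝ] L2 Ω} {G : Space N → Space N → ℝ}

theorem closedForm_cauchySchwarz (hL : IsPositiveSymmetric L) {u v : L2 Ω}
    (hu : u ∈ formDomain L) (hv : v ∈ formDomain L) :
    closedForm L u v ^ 2 ≤ closedForm L u u * closedForm L v v := by
  obtain ⟨φ, hφ⟩ := hu
  obtain ⟨ψ, hψ⟩ := hv
  exact le_of_tendsto_of_tendsto' ((tendsto_testForm hL hφ hψ).pow 2)
    ((tendsto_testForm hL hφ hφ).mul (tendsto_testForm hL hψ hψ))
    fun n => testForm_cauchySchwarz hL _ _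

theorem closedForm_self_nonneg (hL : IsPositiveSymmetric L) {u : L2 Ω} (hu : u ∈ formDomain L) :
    0 ≤ closedForm L u u := by
  obtain ⟨φ, hφ⟩ := hu
  exact ge_of_tendsto' (tendsto_testForm hL hφ hφ) fun n => hL.nonneg _

theorem real_inner_eq_mul (a b : ℝ) : inner ℝ a b = a * b := by
  simp [mul_comm]

theorem lintegral_enorm_sq_eq (f : L2 Ω) :
    ∫⁻ x, ‖f x‖ₑ ^ 2 ∂vol Ω = ENNReal.ofReal (‖f‖ ^ 2) := by
  rw [← real_inner_self_eq_norm_sq, L2.inner_def,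
    ofReal_integral_eq_lintegral_ofReal (L2.integrable_inner f f)
      (Eventually.of_forall fun x => real_inner_self_nonneg)]
  refine lintegral_congr fun x => ?_
  rw [real_inner_self_eq_norm_sq, ENNReal.ofReal_pow (norm_nonneg _), ofReal_norm]

/-- Test functions are dense in `L²(Ω)`. -/
theorem denseRange_testToL2 (Ω : Opens (Space N)) : DenseRange (testToL2 Ω) := by
  have h : (LinearMap.range (testToL2 Ω)).topologicalClosure = ⊤ := by
    rw [Submodule.topologicalClosure_eq_top_iff, Submodule.eq_bot_iff]
    intro f hf
    have hloc : LocallyIntegrable f (vol Ω) :=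
      (Lp.memLp f).locallyIntegrable one_le_two
    have h0 := Ω.isOpen.ae_eq_zero_of_integral_contDiff_smul_eq_zero (f := f) (μ := vol Ω)
      (hloc.locallyIntegrableOn _) fun g hg hgc hgΩ => by
        have h1 := (Submodule.mem_orthogonal _ f).1 hf _
          (LinearMap.mem_range_self (testToL2 Ω) ⟨g, hg, hgc, hgΩ⟩)
        rw [L2.inner_def] at h1
        rw [← h1]
        refine integral_congr_ae ?_
        filter_upwards [(memLp_testFunction Ω ⟨g, hg, hgc, hgΩ⟩).coeFn_toLp] with x hx
        change _ = inner ℝ ((memLp_testFunction Ω ⟨g, hg, hgc, hgΩ⟩).toLp _ x) (f x)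
        rw [hx, real_inner_eq_mul]
        rfl
    rw [Lp.eq_zero_iff_ae_eq_zero]
    filter_upwards [h0, ae_restrict_mem Ω.isOpen.measurableSet] with x hx hxΩ using hx hxΩ
  rw [← Submodule.dense_iff_topologicalClosure_eq_top, LinearMap.coe_range] at h
  exact h

/-- The quadratic form of a kernel with bounded row integrals is continuous in `L²`. -/
theorem kernelForm_add_self_le {X : Type*} [MeasurableSpace X] {K : X × X → ENNReal}
    {ν : Measure X} [SFinite ν] (hK : Measurable K) (hs : ∀ x y, K (x, y) = K (y, x))
    {A : ENNReal} (hA : ∀ x, ∫⁻ y, K (x, y) ∂ν ≤ A) {a b : X → ENNReal} (ha : Measurable a)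
    (hb : Measurable b) {t : ENNReal} (ht : t ≠ 0) (ht' : t ≠ ⊤) :
    kernelForm K ν (fun x => a x + b x) (fun x => a x + b x) ≤
      kernelForm K ν a a + A * (t * (∫⁻ x, a x ^ 2 ∂ν) + (∫⁻ x, b x ^ 2 ∂ν) / t +
        ∫⁻ x, b x ^ 2 ∂ν) := by
  have schur : ∀ f g : X → ENNReal, Measurable f → Measurable g →
      2 * kernelForm K ν f g ≤ A * ((∫⁻ x, f x ^ 2 ∂ν) + ∫⁻ x, g x ^ 2 ∂ν) := by
    intro f g hf hg
    refine (two_mul_kernelForm_le hK hs hf hg (h := fun _ => 1) measurable_const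
      (Eventually.of_forall fun _ => one_ne_zero)
      (Eventually.of_forall fun _ => ENNReal.one_ne_top)).trans ?_
    rw [mul_add, ← lintegral_const_mul _ (hf.pow_const 2),
      ← lintegral_const_mul _ (hg.pow_const 2)]
    have hpot : ∀ x, potential K ν (fun _ => 1) x ≤ A := fun x => by
      simpa [potential] using hA x
    refine add_le_add (lintegral_mono fun x => ?_) (lintegral_mono fun x => ?_)
    all_goals
      rw [div_one, mul_comm]
      exact mul_le_mul_left (hpot x) _
  -- scaling the two arguments by `√t` and `1/√t`
  have cross : 2 * kernelForm K ν a b ≤ A * (t * (∫⁻ x, a x ^ 2 ∂ν) + (∫⁻ x, b x ^ 2 ∂ν) / t) := by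
    set r : ENNReal := t ^ (1 / 2 : ℝ) with hr
    have hr0 : r ≠ 0 := by simp [hr, ht, ht']
    have hrt : r ≠ ⊤ := by simp [hr, ht, ht']
    have hr2 : r ^ 2 = t := by
      rw [hr, ← ENNReal.rpow_natCast, ← ENNReal.rpow_mul]
      norm_num
    have e : kernelForm K ν a b = kernelForm K ν (fun x => r * a x) (fun x => r⁻¹ * b x) := by
      refine lintegral_congr fun x => ?_
      have : potential K ν (fun x => r⁻¹ * b x) x = r⁻¹ * potential K ν b x := by
        have hm : Measurable fun y => K (x, y) * b y := (hK.comp measurable_prodMk_left).mul hb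
        unfold potential
        rw [← lintegral_const_mul _ hm]
        exact lintegral_congr fun y => by ring
      calc a x * potential K ν b x = (r * r⁻¹) * (a x * potential K ν b x) := by
            rw [ENNReal.mul_inv_cancel hr0 hrt, one_mul]
        _ = r * a x * potential K ν (fun x => r⁻¹ * b x) x := by
            rw [this]
            ring
    rw [e]
    refine (schur _ _ (ha.const_mul r) (hb.const_mul r⁻¹)).trans (le_of_eq ?_)
    simp only [mul_pow, hr2]
    rw [lintegral_const_mul _ (ha.pow_const 2), lintegral_const_mul _ (hb.pow_const 2),
      ENNReal.div_eq_inv_mul, ← ENNReal.inv_pow, hr2]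
  have hbb : kernelForm K ν b b ≤ A * ∫⁻ x, b x ^ 2 ∂ν := by
    have h := schur b b hb hb
    rw [← two_mul, mul_left_comm] at h
    exact (ENNReal.mul_le_mul_iff_right two_ne_zero ENNReal.ofNat_ne_top).1 h
  have hab : Measurable fun x => a x + b x := ha.add hb
  rw [kernelForm_add_left hK ha hab, kernelForm_comm hK hs ha hab, kernelForm_comm hK hs hb hab,
    kernelForm_add_left hK ha ha, kernelForm_add_left hK ha hb, kernelForm_comm hK hs hb ha]
  calc kernelForm K ν a a + kernelForm K ν a b + (kernelForm K ν a b + kernelForm K ν b b)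
      = kernelForm K ν a a + (2 * kernelForm K ν a b + kernelForm K ν b b) := by ring
    _ ≤ _ := by
      rw [mul_add A (_ + _)]
      gcongr

theorem measurable_enorm_L2 (f : L2 Ω) : Measurable fun x => ‖f x‖ₑ :=
  (Lp.stronglyMeasurable f).measurable.enorm

/-- The energy inequality for a test function `φ`: since `𝓛 𝔾[φ] = φ`, the Cauchy-Schwarz
inequality for the form gives `(∫ φ ξ)² = 𝓑(𝔾[φ], ξ)² ≤ 𝓑(𝔾[φ], 𝔾[φ]) 𝓑(ξ, ξ)` and
`𝓑(𝔾[φ], 𝔾[φ]) = ∫ φ 𝔾[φ]`. -/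
theorem ofReal_inner_testToL2_sq_le (hN : 0 < N) (hΩ : IsBoundedC2Domain Ω)
    (hE : AdmissibleExponents N s γ) (hG : IsGreenKernel Ω s γ L G)
    (hL : IsPositiveSymmetric L) (φ : 𝓓(Ω, ℝ)) {ξ : L2 Ω} (hξ : ξ ∈ formDomain L) :
    ENNReal.ofReal ((inner ℝ (testToL2 Ω φ) ξ) ^ 2) ≤
      kernelForm (greenKernel Ω G) (vol Ω) (fun x => ‖testToL2 Ω φ x‖ₑ)
        (fun x => ‖testToL2 Ω φ x‖ₑ) * ENNReal.ofReal (closedForm L ξ ξ) := by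
  have hfv := isFiniteMeasure_vol hΩ
  have hK := measurable_greenKernel hG
  obtain ⟨A, hA, hA1, -⟩ := exists_greenKernel_bound hN hΩ hE hG
  obtain ⟨M, hM⟩ := φ.hasCompactSupport.exists_bound_of_continuous φ.continuous
  have hmem : ∀ᵐ x ∂vol Ω, x ∈ Ω := ae_restrict_mem Ω.isOpen.measurableSet
  have hφ : testToL2 Ω φ =ᵐ[vol Ω] φ := (memLp_testFunction Ω φ).coeFn_toLp
  have hpot : ∀ x ∈ Ω, ‖greenOp Ω G φ x‖ₑ ≤
      potential (greenKernel Ω G) (vol Ω) (fun y => ‖φ y‖ₑ) x := by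
    intro x hx
    rw [greenOp_eq_integral hN hG hx]
    refine (enorm_integral_le_lintegral_enorm _).trans (lintegral_mono fun y => ?_)
    rw [enorm_mul, Real.enorm_of_nonneg ENNReal.toReal_nonneg]
    gcongr
    exact ENNReal.ofReal_toReal_le
  have hmeas : AEStronglyMeasurable (greenOp Ω G φ) (vol Ω) := by
    have h1 : AEStronglyMeasurable (fun z : Space N × Space N =>
        (greenKernel Ω G z).toReal * φ z.2) ((vol Ω).prod (vol Ω)) :=
      (hK.ennreal_toReal.mul (φ.continuous.measurable.comp measurable_snd)).aestronglyMeasurable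
    refine h1.integral_prod_right'.congr ?_
    filter_upwards [hmem] with x hx
    exact (greenOp_eq_integral hN hG hx _).symm
  have hmemLp : MemLp (greenOp Ω G φ) 2 (vol Ω) := by
    refine MemLp.of_bound hmeas (A * ENNReal.ofReal M).toReal ?_
    filter_upwards [hmem] with x hx
    have h1 : ‖greenOp Ω G φ x‖ₑ ≤ A * ENNReal.ofReal M := by
      refine (hpot x hx).trans ?_
      calc potential (greenKernel Ω G) (vol Ω) (fun y => ‖φ y‖ₑ) x
          ≤ ∫⁻ y, greenKernel Ω G (x, y) * ENNReal.ofReal M ∂vol Ω := by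
            refine lintegral_mono fun y => mul_le_mul_right ?_ _
            simp only [← ofReal_norm]
            exact ENNReal.ofReal_le_ofReal (hM y)
        _ = (∫⁻ y, greenKernel Ω G (x, y) ∂vol Ω) * ENNReal.ofReal M :=
            lintegral_mul_const' _ _ ENNReal.ofReal_ne_top
        _ ≤ A * ENNReal.ofReal M := mul_le_mul_left (hA1 x) _
    rw [← toReal_enorm]
    exact ENNReal.toReal_mono (by finiteness) h1
  set u : L2 Ω := hmemLp.toLp _ with hu
  have hueq : u =ᵐ[vol Ω] greenOp Ω G φ := hmemLp.coeFn_toLp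
  obtain ⟨huD, huB⟩ := (hG.solves φ u).2 hueq
  have hcs := closedForm_cauchySchwarz hL huD hξ
  rw [huB ξ hξ, huB u huD] at hcs
  have hle : ENNReal.ofReal (inner ℝ (testToL2 Ω φ) u) ≤
      kernelForm (greenKernel Ω G) (vol Ω) (fun x => ‖testToL2 Ω φ x‖ₑ)
        (fun x => ‖testToL2 Ω φ x‖ₑ) := by
    rw [L2.inner_def]
    refine (Real.ofReal_le_enorm _).trans ((enorm_integral_le_lintegral_enorm _).trans ?_)
    refine lintegral_mono_ae ?_
    filter_upwards [hueq, hmem] with x hx hxΩ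
    rw [real_inner_eq_mul, enorm_mul, hx,
      potential_congr_ae (g := fun y => ‖φ y‖ₑ) (hφ.mono fun y hy => by simp only [hy])]
    exact mul_le_mul_right (hpot x hxΩ) _
  refine (ENNReal.ofReal_le_ofReal hcs).trans ?_
  rw [ENNReal.ofReal_mul' (closedForm_self_nonneg hL hξ)]
  exact mul_le_mul_left hle _

/-- The energy inequality `(∫ f ξ)² ≤ (∬ G |f| |f|) 𝓑(ξ, ξ)` for all `f ∈ L²(Ω)`. -/
theorem ofReal_inner_sq_le (hN : 0 < N) (hΩ : IsBoundedC2Domain Ω)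
    (hE : AdmissibleExponents N s γ) (hG : IsGreenKernel Ω s γ L G)
    (hL : IsPositiveSymmetric L) (f : L2 Ω) {ξ : L2 Ω} (hξ : ξ ∈ formDomain L) :
    ENNReal.ofReal ((inner ℝ f ξ) ^ 2) ≤
      kernelForm (greenKernel Ω G) (vol Ω) (fun x => ‖f x‖ₑ) (fun x => ‖f x‖ₑ) *
        ENNReal.ofReal (closedForm L ξ ξ) := by
  have hK := measurable_greenKernel hG
  obtain ⟨A, hA, hA1, -⟩ := exists_greenKernel_bound hN hΩ hE hG
  obtain ⟨g, hgr, hg⟩ := mem_closure_iff_seq_limit.1 (denseRange_testToL2 Ω f)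
  choose φ hφ using hgr
  set k := kernelForm (greenKernel Ω G) (vol Ω) (fun x => ‖f x‖ₑ) (fun x => ‖f x‖ₑ)
  set B := ENNReal.ofReal (closedForm L ξ ξ)
  -- `t n` bounds the distance to `f` and is positive
  set t : ℕ → ℝ := fun n => ‖g n - f‖ + 1 / ((n : ℝ) + 1) with ht
  have htpos : ∀ n, 0 < t n := fun n => by positivity
  have ht0 : Tendsto t atTop (𝓝 0) := by
    have h1 : Tendsto (fun n => ‖g n - f‖) atTop (𝓝 0) := tendsto_iff_norm_sub_tendsto_zero.1 hg
    simpa only [add_zero] using h1.add (tendsto_one_div_add_atTop_nhds_zero_nat (𝕜 := ℝ))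
  have hn : ∀ n, ENNReal.ofReal ((inner ℝ (g n) ξ) ^ 2) ≤
      (k + A * ENNReal.ofReal (t n * ‖f‖ ^ 2 + t n + t n ^ 2)) * B := by
    intro n
    have h1 := ofReal_inner_testToL2_sq_le hN hΩ hE hG hL (φ n) hξ
    rw [hφ n] at h1
    refine h1.trans (mul_le_mul_left ?_ _)
    have h2 : ∀ᵐ x ∂vol Ω, ‖g n x‖ₑ ≤ ‖f x‖ₑ + ‖(g n - f) x‖ₑ := by
      filter_upwards [Lp.coeFn_sub (g n) f] with x hx
      rw [hx, Pi.sub_apply]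
      calc ‖g n x‖ₑ = ‖f x + (g n x - f x)‖ₑ := by rw [add_sub_cancel]
        _ ≤ _ := enorm_add_le _ _
    refine (kernelForm_mono h2).trans ?_
    refine (kernelForm_add_self_le hK (greenKernel_symm hG) hA1 (measurable_enorm_L2 f)
      (measurable_enorm_L2 (g n - f)) (ENNReal.ofReal_pos.2 (htpos n)).ne'
      ENNReal.ofReal_ne_top).trans ?_
    rw [lintegral_enorm_sq_eq, lintegral_enorm_sq_eq,
      ← ENNReal.ofReal_mul (htpos n).le, ← ENNReal.ofReal_div_of_pos (htpos n),
      ← ENNReal.ofReal_add (mul_nonneg (htpos n).le (sq_nonneg _))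
        (div_nonneg (sq_nonneg _) (htpos n).le),
      ← ENNReal.ofReal_add (add_nonneg (mul_nonneg (htpos n).le (sq_nonneg _))
        (div_nonneg (sq_nonneg _) (htpos n).le)) (sq_nonneg _)]
    have h3 : ‖g n - f‖ ≤ t n := by
      simp only [ht]
      have : 0 < 1 / ((n : ℝ) + 1) := by positivity
      linarith
    have h4 : ‖g n - f‖ ^ 2 ≤ t n ^ 2 := pow_le_pow_left₀ (norm_nonneg _) h3 2
    have h5 : ‖g n - f‖ ^ 2 / t n ≤ t n := by
      rw [div_le_iff₀ (htpos n), ← sq]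
      exact h4
    gcongr
  have hl : Tendsto (fun n => ENNReal.ofReal ((inner ℝ (g n) ξ) ^ 2)) atTop
      (𝓝 (ENNReal.ofReal ((inner ℝ f ξ) ^ 2))) :=
    ENNReal.tendsto_ofReal ((hg.inner tendsto_const_nhds).pow 2)
  have hr : Tendsto (fun n => (k + A * ENNReal.ofReal (t n * ‖f‖ ^ 2 + t n + t n ^ 2)) * B)
      atTop (𝓝 (k * B)) := by
    have h1 : Tendsto (fun n => t n * ‖f‖ ^ 2 + t n + t n ^ 2) atTop (𝓝 0) := by
      simpa using ((ht0.mul_const (‖f‖ ^ 2)).add ht0).add (ht0.pow 2)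
    have h2 := ENNReal.Tendsto.const_mul (a := A) (ENNReal.tendsto_ofReal h1) (Or.inr hA)
    have h3 := ENNReal.Tendsto.mul_const (b := B) (h2.const_add k) (Or.inr ENNReal.ofReal_ne_top)
    simpa using h3
  exact le_of_tendsto_of_tendsto' hl hr hn

/-! ### Hardy type inequality from a positive supersolution -/

/-- If the linearized equation with potential `V` has a positive strict supersolution `w`, then
the quadratic form dominates `∫ V ξ²` strictly. The energy inequality is applied to `V ξ`, and
Schur's test with the weight `V w` bounds `∬ G |Vξ| |Vξ|` by `∫ V ξ² 𝔾[V w] / w`, which is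
strictly smaller than `∫ V ξ²`. -/
theorem lintegral_mul_sq_lt_closedForm (hN : 0 < N) (hΩ : IsBoundedC2Domain Ω)
    (hE : AdmissibleExponents N s γ) (hG : IsGreenKernel Ω s γ L G)
    (hL : IsPositiveSymmetric L) {V w : Space N → ENNReal} (hVm : Measurable V)
    (hwm : Measurable w) (hV0 : ∀ᵐ x ∂vol Ω, V x ≠ 0)
    (hwt : ∀ᵐ x ∂vol Ω, w x ≠ ⊤)
    (hsup : ∀ᵐ x ∂vol Ω, potential (greenKernel Ω G) (vol Ω) (fun y => V y * w y) x < w x)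
    {ξ : L2 Ω} (hξ : ξ ∈ formDomain L) (hξ0 : ξ ≠ 0) :
    ∫⁻ x, V x * ‖ξ x‖ₑ ^ 2 ∂vol Ω < ENNReal.ofReal (closedForm L ξ ξ) := by
  have hK := measurable_greenKernel hG
  set P := potential (greenKernel Ω G) (vol Ω) (fun y => V y * w y) with hP
  have hPm : Measurable P := measurable_potential hK (hVm.mul hwm)
  have hξm := measurable_enorm_L2 ξ
  have hw0 : ∀ᵐ x ∂vol Ω, w x ≠ 0 := hsup.mono fun x hx => (zero_le.trans_lt hx).ne'
  set B := ENNReal.ofReal (closedForm L ξ ξ) with hB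
  -- truncations of `V`, for which `V ξ` is square integrable
  set T : ℕ → Space N → ENNReal := fun n x => min (V x) n with hT
  have hTm : ∀ n, Measurable (T n) := fun n => hVm.min measurable_const
  have hTle : ∀ n x, T n x ≤ n := fun n x => min_le_right _ _
  have hTt : ∀ n x, T n x ≠ ⊤ := fun n x => ne_top_of_le_ne_top (ENNReal.natCast_ne_top n) (hTle n x)
  set I : ℕ → ENNReal := fun n => ∫⁻ x, T n x * ‖ξ x‖ₑ ^ 2 ∂vol Ω with hI
  set J : ENNReal := ∫⁻ x, V x * ‖ξ x‖ₑ ^ 2 * (P x / w x) ∂vol Ω with hJ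
  have hIt : ∀ n, I n ≠ ⊤ := by
    intro n
    refine ne_top_of_le_ne_top (b := (n : ENNReal) * ∫⁻ x, ‖ξ x‖ₑ ^ 2 ∂vol Ω) ?_ ?_
    · rw [lintegral_enorm_sq_eq]
      finiteness
    · rw [← lintegral_const_mul _ (hξm.pow_const 2)]
      exact lintegral_mono fun x => mul_le_mul_left (hTle n x) _
  have hkey : ∀ n, 1 ≤ n → I n ^ 2 ≤
      (∫⁻ x, T n x * ‖ξ x‖ₑ ^ 2 * (P x / w x) ∂vol Ω) * B := by
    intro n hn
    have hTn0 : ∀ᵐ x ∂vol Ω, T n x ≠ 0 := hV0.mono fun x hx => by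
      simp only [hT]
      have : (n : ENNReal) ≠ 0 := by exact_mod_cast (by omega : n ≠ 0)
      exact (lt_min (pos_iff_ne_zero.2 hx) (pos_iff_ne_zero.2 this)).ne'
    have hmem : MemLp (fun x => (T n x).toReal * ξ x) 2 (vol Ω) := by
      refine (Lp.memLp ξ).of_le_mul (c := n)
        ((hTm n).ennreal_toReal.aestronglyMeasurable.mul (Lp.aestronglyMeasurable ξ))
        (Eventually.of_forall fun x => ?_)
      rw [norm_mul, Real.norm_of_nonneg ENNReal.toReal_nonneg]
      refine mul_le_mul_of_nonneg_right ?_ (norm_nonneg _)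
      exact ENNReal.toReal_le_of_le_ofReal (Nat.cast_nonneg n) (by simpa using hTle n x)
    set f : L2 Ω := hmem.toLp _ with hf
    have hfe : ∀ᵐ x ∂vol Ω, ‖f x‖ₑ = T n x * ‖ξ x‖ₑ := by
      filter_upwards [hmem.coeFn_toLp] with x hx
      rw [hf, hx, enorm_mul, Real.enorm_of_nonneg ENNReal.toReal_nonneg,
        ENNReal.ofReal_toReal (hTt n x)]
    have hinner : ENNReal.ofReal (inner ℝ f ξ) = I n := by
      rw [L2.inner_def, ofReal_integral_eq_lintegral_ofReal (L2.integrable_inner f ξ)]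
      · refine lintegral_congr_ae ?_
        filter_upwards [hmem.coeFn_toLp] with x hx
        rw [real_inner_eq_mul, hf, hx, mul_assoc, ← sq,
          ENNReal.ofReal_mul ENNReal.toReal_nonneg, ENNReal.ofReal_toReal (hTt n x), ← sq_abs,
          ENNReal.ofReal_pow (abs_nonneg _), ← Real.norm_eq_abs, ofReal_norm]
      · filter_upwards [hmem.coeFn_toLp] with x hx
        rw [Pi.zero_apply, real_inner_eq_mul, hf, hx, mul_assoc, ← sq]
        exact mul_nonneg ENNReal.toReal_nonneg (sq_nonneg _)
    have hinner0 : 0 ≤ inner ℝ f ξ := by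
      rw [L2.inner_def]
      refine integral_nonneg_of_ae ?_
      filter_upwards [hmem.coeFn_toLp] with x hx
      rw [Pi.zero_apply, real_inner_eq_mul, hf, hx, mul_assoc, ← sq]
      exact mul_nonneg ENNReal.toReal_nonneg (sq_nonneg _)
    have h1 := ofReal_inner_sq_le hN hΩ hE hG hL f hξ
    rw [ENNReal.ofReal_pow hinner0, hinner] at h1
    refine h1.trans (mul_le_mul_left ?_ _)
    have h2 := two_mul_kernelForm_le hK (greenKernel_symm hG) (ν := vol Ω)
      (measurable_enorm_L2 f) (measurable_enorm_L2 f) (h := fun x => T n x * w x)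
      ((hTm n).mul hwm)
      (by filter_upwards [hTn0, hw0] with x h1 h2 using mul_ne_zero h1 h2)
      (by filter_upwards [hwt] with x h2 using ENNReal.mul_ne_top (hTt n x) h2)
    rw [← two_mul] at h2
    refine ((ENNReal.mul_le_mul_iff_right two_ne_zero ENNReal.ofNat_ne_top).1 h2).trans
      (lintegral_mono_ae ?_)
    filter_upwards [hfe, hTn0, hw0, hwt] with x hx hx0 hwx0 hwxt
    have hpot : potential (greenKernel Ω G) (vol Ω) (fun y => T n y * w y) x ≤ P x :=
      potential_mono_ae (Eventually.of_forall fun y => mul_le_mul_left (min_le_left _ _) _) x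
    calc ‖f x‖ₑ ^ 2 / (T n x * w x) *
          potential (greenKernel Ω G) (vol Ω) (fun y => T n y * w y) x
        ≤ ‖f x‖ₑ ^ 2 / (T n x * w x) * P x := mul_le_mul_right hpot _
      _ = (T n x * (T n x)⁻¹) * (T n x * ‖ξ x‖ₑ ^ 2 * (P x * (w x)⁻¹)) := by
          rw [hx, ENNReal.div_eq_inv_mul,
            ENNReal.mul_inv (Or.inl hx0) (Or.inl (hTt n x))]
          ring
      _ = T n x * ‖ξ x‖ₑ ^ 2 * (P x / w x) := by
          rw [ENNReal.mul_inv_cancel hx0 (hTt n x), one_mul, div_eq_mul_inv]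
  have hPw : ∀ᵐ x ∂vol Ω, P x / w x < 1 := by
    filter_upwards [hsup, hw0, hwt] with x hx h0 ht
    exact ENNReal.div_lt_of_lt_mul (by rwa [one_mul])
  -- first the nonstrict inequality for the truncations
  have hIB : ∀ n, 1 ≤ n → I n ≤ B := by
    intro n hn
    have h1 : I n ^ 2 ≤ I n * B := by
      refine (hkey n hn).trans (mul_le_mul_left (lintegral_mono_ae ?_) _)
      filter_upwards [hPw] with x hx
      exact mul_le_of_le_one_right' hx.le
    rcases eq_or_ne (I n) 0 with h0 | h0
    · rw [h0]
      exact zero_le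
    · rw [sq] at h1
      exact (ENNReal.mul_le_mul_iff_right h0 (hIt n)).1 h1
  set I' : ENNReal := ∫⁻ x, V x * ‖ξ x‖ₑ ^ 2 ∂vol Ω with hI'
  have hTmono : ∀ x, Monotone fun n => T n x := fun x m n hmn =>
    min_le_min_left _ (by exact_mod_cast hmn)
  have hTlim : ∀ x, Tendsto (fun n => T n x) atTop (𝓝 (V x)) := by
    intro x
    have h := (tendsto_const_nhds (x := V x)).min ENNReal.tendsto_nat_nhds_top
    rwa [min_eq_left le_top] at h
  have hIlim : Tendsto I atTop (𝓝 I') := by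
    refine lintegral_tendsto_of_tendsto_of_monotone
      (fun n => ((hTm n).mul (hξm.pow_const 2)).aemeasurable)
      (Eventually.of_forall fun x m n hmn => mul_le_mul_left (hTmono x hmn) _)
      (Eventually.of_forall fun x => ?_)
    exact ENNReal.Tendsto.mul_const (hTlim x) (Or.inr (by finiteness))
  have hI'B : I' ≤ B := le_of_tendsto hIlim
    (eventually_atTop.2 ⟨1, fun n hn => hIB n hn⟩)
  have hI't : I' ≠ ⊤ := ne_top_of_le_ne_top ENNReal.ofReal_ne_top hI'B
  have hI'J : I' ^ 2 ≤ J * B := by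
    refine le_of_tendsto (ENNReal.Tendsto.pow hIlim) (eventually_atTop.2 ⟨1, fun n hn => ?_⟩)
    refine (hkey n hn).trans (mul_le_mul_left (lintegral_mono fun x => ?_) _)
    exact mul_le_mul_left (mul_le_mul_left (min_le_left _ _) _) _
  -- the set where `ξ` does not vanish has positive measure, which makes `J < I'`
  have hVx : ∀ᵐ x ∂vol Ω, V x * ‖ξ x‖ₑ ^ 2 ≠ ⊤ :=
    (ae_lt_top (hVm.mul (hξm.pow_const 2)) hI't).mono fun x hx => hx.ne
  have hJI : J < I' := by
    refine lintegral_strict_mono_of_ae_le_of_frequently_ae_lt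
      (hVm.mul (hξm.pow_const 2)).aemeasurable ?_ ?_ ?_
    · refine ne_top_of_le_ne_top hI't (lintegral_mono_ae ?_)
      filter_upwards [hPw] with x hx
      exact mul_le_of_le_one_right' hx.le
    · filter_upwards [hPw] with x hx
      exact mul_le_of_le_one_right' hx.le
    · intro hcon
      refine hξ0 ((Lp.eq_zero_iff_ae_eq_zero).2 ?_)
      filter_upwards [hcon, hPw, hV0, hVx] with x hx h1 h2 h3
      by_contra h4
      have h5 : V x * ‖ξ x‖ₑ ^ 2 ≠ 0 := mul_ne_zero h2 (pow_ne_zero _ (enorm_ne_zero.2 h4))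
      refine hx fun h => h1.ne ?_
      rw [← ENNReal.mul_right_inj h5 h3, mul_one]
      exact h
  by_contra hcon
  have hBI : B ≤ I' := not_lt.1 hcon
  have h1 : I' * I' ≤ J * I' := by
    rw [← sq]
    exact hI'J.trans (mul_le_mul_right hBI _)
  have h0 : I' ≠ 0 := (zero_le.trans_lt hJI).ne'
  exact absurd ((ENNReal.mul_le_mul_iff_left h0 hI't).1 h1) (not_le.2 hJI)

end SemilinearGreen

/-! ### The minimal solution and its stability -/

namespace SemilinearGreen

variable {N : ℕ} {Ω : Opens (Space N)} {s γ : ℝ}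
variable {L : 𝓓(Ω, ℝ) →ₗ[ℝ] L2 Ω} {G : Space N → Space N → ℝ}

/-- The minimal solution of `u = 𝔾[u^p] + λ𝔾[μ]` with values in `[0, ∞]`. -/
noncomputable def minimalSol (Ω : Opens (Space N)) (G : Space N → Space N → ℝ) (p : ℝ)
    (μ : Measure (Space N)) (lam : ℝ) : Space N → ENNReal :=
  picardLimit (greenKernel Ω G) (vol Ω)
    (fun x => ENNReal.ofReal lam * datumPotential Ω G μ x) p

/-- The minimal solution lies below every solution with the same or a larger parameter. -/
theorem minimalSol_le (hN : 0 < N) (hΩ : IsBoundedC2Domain Ω)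
    (hE : AdmissibleExponents N s γ) (hG : IsGreenKernel Ω s γ L G) {p : ℝ} (hp : 1 < p)
    {μ : Measure (Space N)} (hμ : IsNormalizedDatum Ω γ μ) {lam lam' : ℝ} (hlam : 0 < lam)
    (hle : lam ≤ lam') {v : Space N → ℝ} (hv : IsNonnegSolution Ω γ p G μ lam' v) :
    ∀ᵐ x ∂vol Ω, minimalSol Ω G p μ lam x ≤ ENNReal.ofReal (v x) := by
  obtain ⟨-, -, -, h⟩ :=
    (isNonnegSolution_iff hN hΩ hE hG hp hμ (hlam.trans_le hle)).1 hv
  refine picardLimit_le (zero_le_one.trans hp.le) ?_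
  filter_upwards [h] with x hx
  rw [hx]
  gcongr

/-- If there is a solution for a larger parameter, then the minimal solution is finite almost
everywhere and solves the problem. -/
theorem isMinimalSolution_toReal (hN : 0 < N) (hΩ : IsBoundedC2Domain Ω)
    (hE : AdmissibleExponents N s γ) (hG : IsGreenKernel Ω s γ L G) {p : ℝ} (hp : 1 < p)
    {μ : Measure (Space N)} (hμ : IsNormalizedDatum Ω γ μ) {lam lam' : ℝ} (hlam : 0 < lam)
    (hle : lam ≤ lam') {v : Space N → ℝ} (hv : IsNonnegSolution Ω γ p G μ lam' v) :
    IsMinimalSolution Ω γ p G μ lam fun x => (minimalSol Ω G p μ lam x).toReal := by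
  have hp0 : 0 < p := by linarith
  have hK := measurable_greenKernel hG
  have hD := (measurable_datumPotential hN hΩ hG hμ).const_mul (ENNReal.ofReal lam)
  have hm : Measurable (minimalSol Ω G p μ lam) := measurable_picardLimit hK hD p
  have hUv := minimalSol_le hN hΩ hE hG hp hμ hlam hle hv
  have hUr : ∀ᵐ x ∂vol Ω, ENNReal.ofReal (minimalSol Ω G p μ lam x).toReal =
      minimalSol Ω G p μ lam x := hUv.mono fun x hx =>
    ENNReal.ofReal_toReal (ne_top_of_le_ne_top ENNReal.ofReal_ne_top hx)
  obtain ⟨-, -, hvfin, -⟩ :=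
    (isNonnegSolution_iff hN hΩ hE hG hp hμ (hlam.trans_le hle)).1 hv
  refine ⟨(isNonnegSolution_iff hN hΩ hE hG hp hμ hlam).2
    ⟨Eventually.of_forall fun _ => ENNReal.toReal_nonneg, hm.ennreal_toReal.aemeasurable,
      ne_top_of_le_ne_top hvfin (lintegral_mono_ae ?_), ?_⟩, fun z hz => ?_⟩
  · filter_upwards [hUv, hUr] with x h1 h2
    rw [h2]
    gcongr
  · filter_upwards [hUr] with x hx
    rw [hx, potential_congr_ae (g := fun y => minimalSol Ω G p μ lam y ^ p)
      (hUr.mono fun y hy => by simp only [hy])]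
    exact picardLimit_eq hK hD hp0 x
  · filter_upwards [minimalSol_le hN hΩ hE hG hp hμ hlam le_rfl hz, hz.1] with x hx hx0
    exact ENNReal.toReal_le_of_le_ofReal hx0 hx

/-- The minimal solution is stable if there is a solution `v` for a strictly larger parameter:
by convexity of `t ↦ t^p` the difference `v - u` is a strict supersolution of the linearized
equation. -/
theorem lintegral_minimalSol_lt (hN : 0 < N) (hΩ : IsBoundedC2Domain Ω)
    (hE : AdmissibleExponents N s γ) (hG : IsGreenKernel Ω s γ L G)
    (hL : IsPositiveSymmetric L) {p : ℝ} (hp : 1 < p)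
    {μ : Measure (Space N)} (hμ : IsNormalizedDatum Ω γ μ) {lam lam' : ℝ} (hlam : 0 < lam)
    (hlt : lam < lam') {v : Space N → ℝ} (hv : IsNonnegSolution Ω γ p G μ lam' v)
    {ξ : L2 Ω} (hξ : ξ ∈ formDomain L) (hξ0 : ξ ≠ 0) :
    ∫⁻ x, ENNReal.ofReal p * minimalSol Ω G p μ lam x ^ (p - 1) * ‖ξ x‖ₑ ^ 2 ∂vol Ω <
      ENNReal.ofReal (closedForm L ξ ξ) := by
  have hp0 : 0 < p := by linarith
  have hK := measurable_greenKernel hG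
  set D := datumPotential Ω G μ
  have hDm : Measurable D := measurable_datumPotential hN hΩ hG hμ
  have hDl := hDm.const_mul (ENNReal.ofReal lam)
  have hDpos : ∀ᵐ x ∂vol Ω, 0 < D x := ae_datumPotential_pos hN hG hμ
  set U := minimalSol Ω G p μ lam with hU
  have hUm : Measurable U := measurable_picardLimit hK hDl p
  have hUeq : ∀ x, U x = potential (greenKernel Ω G) (vol Ω) (fun y => U y ^ p) x +
      ENNReal.ofReal lam * D x := picardLimit_eq hK hDl hp0
  have hUv := minimalSol_le hN hΩ hE hG hp hμ hlam hlt.le hv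
  obtain ⟨hv0, hvm, -, hveq⟩ :=
    (isNonnegSolution_iff hN hΩ hE hG hp hμ (hlam.trans hlt)).1 hv
  have hUt : ∀ᵐ x ∂vol Ω, U x ≠ ⊤ := hUv.mono fun x hx =>
    ne_top_of_le_ne_top ENNReal.ofReal_ne_top hx
  have hU0 : ∀ᵐ x ∂vol Ω, U x ≠ 0 := by
    filter_upwards [hDpos] with x hx
    rw [hUeq x]
    exact (lt_of_lt_of_le (ENNReal.mul_pos (ENNReal.ofReal_pos.2 hlam).ne' hx.ne')
      le_add_self).ne'
  set w : Space N → ENNReal := fun x => ENNReal.ofReal (hvm.mk v x) - U x with hw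
  have hwm : Measurable w := hvm.measurable_mk.ennreal_ofReal.sub hUm
  have hvw : ∀ᵐ x ∂vol Ω, ENNReal.ofReal (v x) = U x + w x := by
    filter_upwards [hvm.ae_eq_mk, hUv] with x h1 h2
    simp only [hw]
    rw [← h1, add_tsub_cancel_of_le h2]
  have hwt : ∀ᵐ x ∂vol Ω, w x ≠ ⊤ := Eventually.of_forall fun x =>
    ne_top_of_le_ne_top ENNReal.ofReal_ne_top tsub_le_self
  set V : Space N → ENNReal := fun x => ENNReal.ofReal p * U x ^ (p - 1) with hV
  have hVm : Measurable V := (hUm.pow_const _).const_mul _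
  have hV0 : ∀ᵐ x ∂vol Ω, V x ≠ 0 := by
    filter_upwards [hU0, hUt] with x h1 h2
    exact mul_ne_zero (ENNReal.ofReal_pos.2 hp0).ne' (ENNReal.rpow_pos (pos_iff_ne_zero.2 h1) h2).ne'
  refine lintegral_mul_sq_lt_closedForm hN hΩ hE hG hL hVm hwm hV0 hwt ?_ hξ hξ0
  have hconv : ∀ᵐ y ∂vol Ω, U y ^ p + V y * w y ≤ ENNReal.ofReal (v y) ^ p := by
    filter_upwards [hvw, hUt] with y h1 h2
    rw [h1]
    exact rpow_add_mul_le_add_rpow hp h2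
  filter_upwards [hveq, hvw, hUt, hDpos, hwt] with x h1 h2 h3 h4 h5
  set P := potential (greenKernel Ω G) (vol Ω) (fun y => V y * w y) x with hP
  have hge : U x + (P + ENNReal.ofReal (lam' - lam) * D x) ≤ U x + w x := by
    calc U x + (P + ENNReal.ofReal (lam' - lam) * D x)
        = (potential (greenKernel Ω G) (vol Ω) (fun y => U y ^ p) x + P) +
            (ENNReal.ofReal lam + ENNReal.ofReal (lam' - lam)) * D x := by
          rw [hUeq x]
          ring
      _ = potential (greenKernel Ω G) (vol Ω) (fun y => U y ^ p + V y * w y) x +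
            ENNReal.ofReal lam' * D x := by
          rw [potential_add hK (hUm.pow_const p), ← ENNReal.ofReal_add hlam.le
            (sub_nonneg.2 hlt.le), add_sub_cancel]
      _ ≤ potential (greenKernel Ω G) (vol Ω) (fun y => ENNReal.ofReal (v y) ^ p) x +
            ENNReal.ofReal lam' * D x := add_le_add_left (potential_mono_ae hconv x) _
      _ = U x + w x := by rw [← h2, h1]
  have hge' := (ENNReal.add_le_add_iff_left h3).1 hge
  have hPt : P ≠ ⊤ := ne_top_of_le_ne_top h5 (le_self_add.trans hge')
  refine lt_of_lt_of_le (ENNReal.lt_add_right hPt ?_) hge'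
  exact (ENNReal.mul_pos (ENNReal.ofReal_pos.2 (sub_pos.2 hlt)).ne' h4.ne').ne'

/-- Transfer of the strict inequality from `[0, ∞]`-valued integrals to `IsStable`. -/
theorem isStable_of_lintegral_lt {p : ℝ} (hp : 1 < p) {U : Space N → ENNReal}
    {u : Space N → ℝ} (hu : AEMeasurable u (vol Ω)) (hu0 : ∀ᵐ x ∂vol Ω, 0 ≤ u x)
    (huU : ∀ᵐ x ∂vol Ω, ENNReal.ofReal (u x) ≤ U x)
    (h : ∀ ξ ∈ formDomain L, ξ ≠ 0 →
      ∫⁻ x, ENNReal.ofReal p * U x ^ (p - 1) * ‖ξ x‖ₑ ^ 2 ∂vol Ω <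
        ENNReal.ofReal (closedForm L ξ ξ)) :
    IsStable L p u := by
  have hp0 : 0 < p := by linarith
  intro ξ hξ hξ0
  have hlt := h ξ hξ hξ0
  have hm : AEStronglyMeasurable (fun x => u x ^ (p - 1) * ξ x ^ 2) (vol Ω) :=
    (hu.pow_const _).aestronglyMeasurable.mul ((Lp.aestronglyMeasurable ξ).pow 2)
  have hnn : ∀ᵐ x ∂vol Ω, 0 ≤ u x ^ (p - 1) * ξ x ^ 2 :=
    hu0.mono fun x hx => mul_nonneg (Real.rpow_nonneg hx _) (sq_nonneg _)
  have hle : ∫⁻ x, ENNReal.ofReal p * ENNReal.ofReal (u x ^ (p - 1) * ξ x ^ 2) ∂vol Ω ≤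
      ∫⁻ x, ENNReal.ofReal p * U x ^ (p - 1) * ‖ξ x‖ₑ ^ 2 ∂vol Ω := by
    refine lintegral_mono_ae ?_
    filter_upwards [hu0, huU] with x hx hxU
    rw [ENNReal.ofReal_mul (Real.rpow_nonneg hx _),
      ← ENNReal.ofReal_rpow_of_nonneg hx (sub_nonneg.2 hp.le), mul_assoc, ← sq_abs,
      ENNReal.ofReal_pow (abs_nonneg _), ← Real.norm_eq_abs, ofReal_norm]
    gcongr
  rw [lintegral_const_mul' _ _ ENNReal.ofReal_ne_top] at hle
  have hlt' := hle.trans_lt hlt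
  have hfin : ∫⁻ x, ENNReal.ofReal (u x ^ (p - 1) * ξ x ^ 2) ∂vol Ω < ⊤ := by
    refine lt_top_iff_ne_top.2 fun hcon => ?_
    rw [hcon, ENNReal.mul_top (ENNReal.ofReal_pos.2 hp0).ne'] at hlt'
    exact not_top_lt hlt'
  have hint : Integrable (fun x => u x ^ (p - 1) * ξ x ^ 2) (vol Ω) :=
    ⟨hm, (hasFiniteIntegral_iff_ofReal hnn).2 hfin⟩
  refine ⟨hint, ?_⟩
  rw [← ofReal_integral_eq_lintegral_ofReal hint hnn, ← ENNReal.ofReal_mul hp0.le] at hlt'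
  exact (ENNReal.ofReal_lt_ofReal_iff').1 hlt' |>.1

end SemilinearGreen

theorem proposition7p2 {N : ℕ} (Ω : TopologicalSpace.Opens (EuclideanSpace ℝ (Fin N)))
    (hΩ : SemilinearGreen.IsBoundedC2Domain Ω)
    (s γ : ℝ)
    (L : 𝓓(Ω, ℝ) →ₗ[ℝ] SemilinearGreen.L2 Ω)
    (G : EuclideanSpace ℝ (Fin N) → EuclideanSpace ℝ (Fin N) → ℝ)
    (hK1 : SemilinearGreen.IsGreenKernel Ω s γ L G)
    (hK2 : SemilinearGreen.AdmissibleExponents N s γ)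
    (hK3 : SemilinearGreen.IsPositiveSymmetric L)
    (hK4 : ∀ u : SemilinearGreen.L2 Ω,
      u ∈ SemilinearGreen.formDomain L ↔ SemilinearGreen.MemHs00 Ω s u)
    (hK5 : SemilinearGreen.dimThreshold s γ ≤ (N : ℝ))
    (p : ℝ) (hp : 1 < p) (hp' : p < SemilinearGreen.pStar N s γ)
    (μ : MeasureTheory.Measure (EuclideanSpace ℝ (Fin N)))
    (hμ : SemilinearGreen.IsNormalizedDatum Ω γ μ)
    (lam : ℝ) (hlam : 0 < lam)
    (hlam' : (lam : EReal) < SemilinearGreen.lambdaStar Ω γ p G μ) :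
    (∃ u, SemilinearGreen.IsMinimalSolution Ω γ p G μ lam u) ∧
      ∀ u, SemilinearGreen.IsMinimalSolution Ω γ p G μ lam u → SemilinearGreen.IsStable L p u := by
  have hN : 0 < N := by
    have h1 := hK2.s_pos
    have h2 := hK2.dim
    have h3 : (0 : ℝ) < N := by linarith
    exact_mod_cast h3
  obtain ⟨_, ⟨lam', rfl, -, v, hv0, hv⟩, hlt⟩ := lt_sSup_iff.1 hlam'
  have hlt' : lam < lam' := EReal.coe_lt_coe_iff.1 hlt
  have hvs : SemilinearGreen.IsNonnegSolution Ω γ p G μ lam' v :=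
    ⟨hv0.mono fun x hx => hx.le, hv⟩
  have hmin := SemilinearGreen.isMinimalSolution_toReal hN hΩ hK2 hK1 hp hμ hlam hlt'.le hvs
  refine ⟨⟨_, hmin⟩, fun u hu => ?_⟩
  obtain ⟨hu0, hum, -, -⟩ :=
    (SemilinearGreen.isNonnegSolution_iff hN hΩ hK2 hK1 hp hμ hlam).1 hu.1
  refine SemilinearGreen.isStable_of_lintegral_lt hp hum hu0
    (U := SemilinearGreen.minimalSol Ω G p μ lam) ?_ fun ξ hξ hξ0 =>
      SemilinearGreen.lintegral_minimalSol_lt hN hΩ hK2 hK1 hK3 hp hμ hlam hlt' hvs hξ hξ0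
  filter_upwards [hu.2 _ hmin.1] with x hx using
    (ENNReal.ofReal_le_ofReal hx).trans ENNReal.ofReal_toReal_le
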